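/- Two-sided game of Googol. There are $n\ge 1$ cards, with $2n$ different non-negative numbers written on their $2n$ sides. Each card independently lands with a uniformly random side facing up; let $\mathcal U$ be the numbers facing up and $\mathcal D=\{D_1,\dots,D_n\}$ those facing down. The numbers in $\mathcal U$ are seen, and then the cards are flipped one at a time in a uniformly random order $\sigma$. Let $Y_1>Y_2>\dots>Y_{2n}$ be the $2n$ numbers in decreasing order, and let $k$ be the smallest index such that $Y_k$ is on the same card as some $Y_{k'}$ with $k'<k$. For $0\le t\le 1$ the algorithm $\mathrm{ALG}(t)$ draws $n$ independent uniform numbers in $[0,1]$ and sorts them as $\tau_1<\dots<\tau_n$. The hidden value revealed at step $s$ gets arrival time $\tau_s$, and the value that was facing up on the same card gets arrival time $\tau_s-1$. The algorithm stops at the first step $s$ at which the revealed value $D_{\sigma(s)}$ is larger than every value with arrival time in $[\max(\tau_s-1-t,-1),\tau_s)$, and obtains that value; if there is no such step it obtains $0$. Let $\mathbb E[\mathrm{ALG}(t)]$ be its expected obtained value. Let $R_\infty(t)=\frac t2+\ln\frac{2}{1+t}$. Then the equation $$2-\tfrac{5t}{2}-(3+t)\ln 2+(4+t)\ln(1+t)=0$$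 has exactly one root $t^*$ in $(-1,\infty)$; it lies in $(0,1)$, $t^*\approx 0.1128904$ (error less than $5\cdot 10^{-8}$), and $R_\infty(t^*)=0.6426317\ldots$. Moreover: 1. For every $\varepsilon>0$ there is a $K$ such that for every $n\ge1$ and every instance with $n$ cards and $k\ge K$, $\ \mathbb E[\mathrm{ALG}(t^*)]/\mathbb E[\max\mathcal D]\ge R_\infty(t^*)-\varepsilon$. 2. For every $n\ge1$ and every instance with $n$ cards, $\mathbb E[\max\mathcal D]>0$ and $$\frac{\mathbb E[\mathrm{ALG}(t^*)]}{\mathbb E[\max\mathcal D]}\ \ge\ R_\infty(t^*)-\frac{16k}{2^k}.$$ -/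

import Mathlib

open MeasureTheory

noncomputable section

namespace Googol

/-- An instance of the two-sided game of Googol with `n` cards: `val i s` is the number written
on side `s` of card `i`. The `2n` numbers are non-negative and pairwise different. -/
structure Instance (n : ℕ) where
  val : Fin n → Bool → ℝ
  nonneg : ∀ i s, 0 ≤ val i s
  inj : ∀ i s j s', val i s = val j s' → i = j ∧ s = s'

/-- The position (starting at `1`) of the number on side `s` of card `i` when all the `2n` numbers
are listed in decreasing order `Y_1 > Y_2 > ⋯ > Y_{2n}`: the number of values that are at
least as large. -/
def Instance.rank {n : ℕ} (I : Instance n) (i : Fin n) (s : Bool) : ℕ :=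
  Nat.card {p : Fin n × Bool // I.val i s ≤ I.val p.1 p.2}

/-- The smallest index `k` such that `Y_k` is on the same card as `Y_{k'}` for some `k' < k`. -/
def Instance.k {n : ℕ} (I : Instance n) : ℕ :=
  sInf {j : ℕ | ∃ i s, I.rank i s = j ∧ I.rank i (!s) < j}

/-- The discrete measurable structure on the finite set of permutations of the cards. -/
instance permMeasurableSpace (n : ℕ) : MeasurableSpace (Equiv.Perm (Fin n)) := ⊤

/-- An outcome of all the randomness: the side of each card that lands facing up, the order in
which the cards are flipped (card `σ s` is flipped at step `s`), and the `n` numbers drawn by the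
algorithm. -/
abbrev Outcome (n : ℕ) : Type := (Fin n → Bool) × Equiv.Perm (Fin n) × (Fin n → ℝ)

/-- The law of the outcome: independent fair coins, an independent uniformly random permutation,
and independent uniform numbers in `[0, 1]`. -/
def law (n : ℕ) : Measure (Outcome n) :=
  (Measure.pi fun _ : Fin n => (PMF.uniformOfFintype Bool).toMeasure).prod
    ((PMF.uniformOfFintype (Equiv.Perm (Fin n))).toMeasure.prod
      (Measure.pi fun _ : Fin n => (volume : Measure ℝ).restrict (Set.Icc 0 1)))

variable {n : ℕ}

/-- The number on card `i` that landed facing up. -/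
def Instance.up (I : Instance n) (w : Outcome n) (i : Fin n) : ℝ := I.val i (w.1 i)

/-- The number on card `i` that landed facing down. -/
def Instance.down (I : Instance n) (w : Outcome n) (i : Fin n) : ℝ := I.val i (!(w.1 i))

/-- The arrival times `τ_1 ≤ τ_2 ≤ ⋯ ≤ τ_n` of the hidden values in the order in which they are
revealed: the drawn numbers, sorted increasingly. The value facing up on the card that is flipped
at step `s` is given the arrival time `τ_s - 1`. -/
def tau (w : Outcome n) (s : Fin n) : ℝ := w.2.2 (Tuple.sort w.2.2 s)

/-- The moving window `[max (θ - 1 - t) (-1), θ)` of an element that arrives at time `θ`. -/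
def window (t θ : ℝ) : Set ℝ := Set.Ico (max (θ - 1 - t) (-1)) θ

/-- The hidden value revealed at step `s` is acceptable: it is larger than every value, initially
visible or hidden, that arrives in its window. -/
def Instance.Accepts (I : Instance n) (t : ℝ) (w : Outcome n) (s : Fin n) : Prop :=
  ∀ r : Fin n,
    (tau w r - 1 ∈ window t (tau w s) → I.up w (w.2.1 r) < I.down w (w.2.1 s)) ∧
    (tau w r ∈ window t (tau w s) → I.down w (w.2.1 r) < I.down w (w.2.1 s))

/-- `ALG(t)` stops at step `s`: this is the first acceptable step. -/
def Instance.StopsAt (I : Instance n) (t : ℝ) (w : Outcome n) (s : Fin n) : Prop :=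
  I.Accepts t w s ∧ ∀ r < s, ¬ I.Accepts t w r

open Classical in
/-- The value selected by `ALG(t)`; it is `0` if the algorithm never stops. At most one summand
is different from `0`. -/
def Instance.alg (I : Instance n) (t : ℝ) (w : Outcome n) : ℝ :=
  ∑ s : Fin n, if I.StopsAt t w s then I.down w (w.2.1 s) else 0

/-- `max 𝒟`, the largest number that landed facing down. -/
def Instance.maxDown (I : Instance n) (w : Outcome n) : ℝ := ⨆ i : Fin n, I.down w i

/-- `𝔼[ALG(t)]`. -/
def Instance.expAlg (I : Instance n) (t : ℝ) : ℝ := ∫ w, I.alg t w ∂(law n)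

/-- `𝔼[max 𝒟]`. -/
def Instance.expMax (I : Instance n) : ℝ := ∫ w, I.maxDown w ∂(law n)

/-- `R_∞(t) = t / 2 + ln (2 / (1 + t))`. -/
def Rinf (t : ℝ) : ℝ := t / 2 + Real.log (2 / (1 + t))

/-- The function whose root is `t*`. -/
def rootFun (t : ℝ) : ℝ :=
  2 - 5 * t / 2 - (3 + t) * Real.log 2 + (4 + t) * Real.log (1 + t)

end Googol

end

open MeasureTheory

noncomputable section

namespace Googol

/-! ### The root of the equation -/

/-! Put m = k - 1. The m largest values lie on m different cards. A sorted iid uniform sample put in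
uniformly random order is iid again, and a coin decides whether a time is shifted by -1; hence the
arrival times of these m values are independent and uniform on [-1, 1] (`iIndepFun_position`,
`map_position`).

Count the largest values from 0. Suppose the i-th one is hidden and no larger value arrives in its
window. It is obtained unless an earlier step is accepted. In that case look at the largest hidden
value d revealed before it. Either d is the l-th largest value for some l > i with l < m, and no
larger value except the i-th arrives between the start of the window of d and the i-th value; or d
lies below all m top values, none of which then arrives in the window of the i-th one, an event of
probability at most 2^(-m) (`Instance.IsTop.alg_eq`). A union bound over l, with a geometric series
under the integral, shows that the i-th value is obtained with probability at least 2^(-(i+1)) *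
`selectWeight t i` - 2^(-m).

Let T_j be `tailWeight t j`. Then `selectWeight t j` = 2 T_j - T_(j+1), so the first j main terms
sum to T_0 - 2^(-j) T_j, where T_0 is `Rinf t`. The equation for t says precisely that T_1 = T_0,
and T_j decreases from j = 1 on, so T_j ≤ T_0 for all j (`le_sum_selectWeight`). Thus one of the j
largest values is obtained with probability at least `Rinf t` * (1 - 2^(-j)) - j 2^(-m), while for j
< m one of them is hidden with probability 1 - 2^(-j). The ratio therefore holds at every threshold
(`Instance.IsTop.mul_measure_le`), and integrating over thresholds gives it for the expectations. -/

lemma hasDerivAt_rootFun {t : ℝ} (ht : -1 < t) :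
    HasDerivAt rootFun (-3 / 2 - Real.log 2 + Real.log (1 + t) + 3 / (1 + t)) t := by
  have h0 : (1 + t) ≠ 0 := by linarith
  have h1 : HasDerivAt (fun t : ℝ => Real.log (1 + t)) (1 / (1 + t)) t :=
    ((hasDerivAt_id t).const_add 1).log h0
  have h2 : HasDerivAt (fun t : ℝ => (4 + t) * Real.log (1 + t))
      (1 * Real.log (1 + t) + (4 + t) * (1 / (1 + t))) t :=
    ((hasDerivAt_id t).const_add 4).mul h1
  have h3 : HasDerivAt (fun t : ℝ => (3 + t) * Real.log 2) (1 * Real.log 2) t :=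
    ((hasDerivAt_id t).const_add 3).mul_const _
  have h4 : HasDerivAt (fun t : ℝ => 2 - 5 * t / 2) (-(5 * 1 / 2)) t :=
    (((hasDerivAt_id t).const_mul 5).div_const 2).const_sub 2
  convert! (h4.sub h3).add h2 using 1
  field_simp
  ring

lemma continuousOn_rootFun : ContinuousOn rootFun (Set.Ioi (-1)) := fun _ ht =>
  (hasDerivAt_rootFun ht).continuousAt.continuousWithinAt

/-- By log y ≥ 1 - 1/y at y = (1 + t)/2, the derivative is at least 1/(1 + t) - 1/2, which is
positive for t < 1. -/
lemma rootFun_strictMonoOn : StrictMonoOn rootFun (Set.Ioc (-1) 1) := by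
  refine strictMonoOn_of_deriv_pos (convex_Ioc _ _)
    (continuousOn_rootFun.mono Set.Ioc_subset_Ioi_self) fun t ht => ?_
  rw [interior_Ioc] at ht
  obtain ⟨h1, h2⟩ := ht
  rw [(hasDerivAt_rootFun h1).deriv]
  have h0 : 0 < 1 + t := by linarith
  have := Real.one_sub_inv_le_log_of_pos (div_pos h0 (two_pos : (0 : ℝ) < 2))
  rw [Real.log_div h0.ne' two_ne_zero, inv_div] at this
  have e : 2 / (1 + t) = 3 / (1 + t) - 1 / (1 + t) := by ring
  have : 1 / 2 < 1 / (1 + t) := one_div_lt_one_div_of_lt h0 (by linarith)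
  linarith

/-- At x = 1 + t the derivative of `rootFun` is log x + 3/x up to a constant. This function falls
until x = 3 and rises afterwards, so its values at a few points control the derivative. -/
lemma log_add_three_div_mono {a b : ℝ} (ha : 3 ≤ a) (hab : a ≤ b) :
    Real.log a + 3 / a ≤ Real.log b + 3 / b := by
  have ha0 : 0 < a := by linarith
  have hb0 : 0 < b := by linarith
  have := Real.one_sub_inv_le_log_of_pos (div_pos hb0 ha0)
  rw [Real.log_div hb0.ne' ha0.ne', inv_div] at this
  have h : 3 / a - 3 / b ≤ 1 - a / b := by
    have : 1 - a / b - (3 / a - 3 / b) = (b - a) * (a - 3) / (a * b) := by field_simp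
    have : 0 ≤ (b - a) * (a - 3) / (a * b) :=
      div_nonneg (mul_nonneg (by linarith) (by linarith)) (by positivity)
    linarith
  linarith

lemma log_add_three_div_anti {a b : ℝ} (ha : 0 < a) (hab : a ≤ b) (hb : b ≤ 3) :
    Real.log b + 3 / b ≤ Real.log a + 3 / a := by
  have hb0 : 0 < b := by linarith
  have := Real.log_le_sub_one_of_pos (div_pos hb0 ha)
  rw [Real.log_div hb0.ne' ha.ne'] at this
  have h : b / a - 1 ≤ 3 / a - 3 / b := by
    have : 3 / a - 3 / b - (b / a - 1) = (b - a) * (3 - b) / (a * b) := by field_simp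
    have : 0 ≤ (b - a) * (3 - b) / (a * b) :=
      div_nonneg (mul_nonneg (by linarith) (by linarith)) (by positivity)
    linarith
  linarith

lemma log_twentyfour_fifths : Real.log (24 / 5) = 3 * Real.log 2 + Real.log 3 - Real.log 5 := by
  rw [Real.log_div (by norm_num) (by norm_num), show (24 : ℝ) = 2 ^ 3 * 3 by norm_num,
    Real.log_mul (by norm_num) (by norm_num), Real.log_pow]
  norm_num

lemma rootFun_large_gt : 0.01 < rootFun (19 / 5) := by
  rw [rootFun, show (1 : ℝ) + 19 / 5 = 24 / 5 by norm_num, log_twentyfour_fifths]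
  linarith [Real.log_two_gt_d9, Real.log_two_lt_d9, Real.log_three_gt_d9, Real.log_five_lt_d9]

/-- Beyond 1 the function first decreases and then increases. The minimum lies just before 19/5,
where the value still exceeds 0.01. -/
lemma rootFun_pos_of_one_le {t : ℝ} (ht : 1 ≤ t) : 0 < rootFun t := by
  have hl := log_twentyfour_fifths
  have n1 := Real.log_two_gt_d9
  have n2 := Real.log_two_lt_d9
  have n3 := Real.log_three_gt_d9
  have n4 := Real.log_three_lt_d9
  have n5 := Real.log_five_gt_d9
  have n6 := Real.log_five_lt_d9
  have hd (x : ℝ) (hx : -1 < x) := hasDerivAt_rootFun hx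
  rcases le_total t (19 / 5) with h | h
  -- At 19/5 the derivative is already positive but below 0.001. Subtracting 0.001 x restores
  -- monotonicity on all of [1, 19/5] and costs at most 0.0028, less than 0.01.
  · have hanti : AntitoneOn (fun x => rootFun x - 0.001 * x) (Set.Icc 1 (19 / 5)) := by
      have hd' (x : ℝ) (hx : -1 < x) : HasDerivAt (fun x => rootFun x - 0.001 * x) _ x :=
        (hd x hx).sub ((hasDerivAt_id x).const_mul (0.001 : ℝ))
      refine antitoneOn_of_deriv_nonpos (convex_Icc _ _)
        (fun x hx => (hd' x (by linarith [hx.1])).continuousAt.continuousWithinAt)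
        (fun x hx => ?_) fun x hx => ?_
      · rw [interior_Icc] at hx
        exact (hd' x (by linarith [hx.1])).differentiableAt.differentiableWithinAt
      · rw [interior_Icc] at hx
        rw [(hd' x (by linarith [hx.1])).deriv]
        rcases le_total x 2 with h2 | h2
        · have := log_add_three_div_anti (a := 2) (b := 1 + x) two_pos (by linarith [hx.1])
            (by linarith)
          linarith
        · have := log_add_three_div_mono (a := 1 + x) (b := 24 / 5) (by linarith)
            (by linarith [hx.2])
          norm_num at this ⊢
          linarith
    have h1 := hanti ⟨ht, h⟩ (Set.right_mem_Icc.2 (ht.trans h)) h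
    have := rootFun_large_gt
    simp only at h1
    linarith
  · have hmono : MonotoneOn rootFun (Set.Ici (19 / 5)) := by
      refine monotoneOn_of_deriv_nonneg (convex_Ici _)
        (fun x hx => (hd x (by linarith [hx.out])).continuousAt.continuousWithinAt)
        (fun x hx => ?_) fun x hx => ?_
      · rw [interior_Ici] at hx
        exact (hd x (by linarith [hx.out])).differentiableAt.differentiableWithinAt
      · rw [interior_Ici] at hx
        rw [(hd x (by linarith [hx.out])).deriv]
        have := log_add_three_div_mono (a := 24 / 5) (b := 1 + x) (by norm_num)
            (by linarith [hx.out])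
        norm_num at this ⊢
        linarith
    have := hmono Set.self_mem_Ici h h
    linarith [rootFun_large_gt]

/-! ### Numerical enclosure of the root and of `Rinf` there -/

lemma abs_log_one_add_sub {x : ℝ} (h0 : 0 ≤ x) (h1 : x < 1) (n : ℕ) :
    |(∑ i ∈ Finset.range n, (-x) ^ (i + 1) / (i + 1)) + Real.log (1 + x)| ≤
      x ^ (n + 1) / (1 - x) := by
  have := Real.abs_log_sub_add_sum_range_le (x := -x) (by rwa [abs_neg, abs_of_nonneg h0]) n
  rwa [abs_neg, abs_of_nonneg h0, sub_neg_eq_add] at this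

lemma log_lower_bounds : 0.10696058 < Real.log (1 + 0.112890385) ∧
    Real.log (1 + 0.112890385) < 0.106960582 := by
  have := abs_le.1 (abs_log_one_add_sub (x := 0.112890385) (by norm_num) (by norm_num) 11)
  simp only [Finset.sum_range_succ, Finset.sum_range_zero] at this
  norm_num at this ⊢
  constructor <;> linarith

lemma log_upper_bounds : 0.106960612 < Real.log (1 + 0.11289042) ∧
    Real.log (1 + 0.11289042) < 0.106960613 := by
  have := abs_le.1 (abs_log_one_add_sub (x := 0.11289042) (by norm_num) (by norm_num) 11)
  simp only [Finset.sum_range_succ, Finset.sum_range_zero] at this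
  norm_num at this ⊢
  constructor <;> linarith

lemma rinf_antitoneOn : AntitoneOn Rinf (Set.Icc 0 1) := by
  intro a ha b hb hab
  have ha0 : 0 < 1 + a := by linarith [ha.1]
  have hb0 : 0 < 1 + b := by linarith [hb.1]
  have := Real.one_sub_inv_le_log_of_pos (div_pos hb0 ha0)
  rw [Real.log_div hb0.ne' ha0.ne', inv_div] at this
  rw [Rinf, Rinf, Real.log_div two_ne_zero ha0.ne', Real.log_div two_ne_zero hb0.ne']
  have : (b - a) / 2 ≤ 1 - (1 + a) / (1 + b) := by
    have e : 1 - (1 + a) / (1 + b) - (b - a) / 2 = (b - a) * (1 - b) / (2 * (1 + b)) := by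
      field_simp; ring
    have : 0 ≤ (b - a) * (1 - b) / (2 * (1 + b)) :=
      div_nonneg (mul_nonneg (by linarith) (by linarith [hb.2])) (by positivity)
    linarith
  linarith

lemma exists_root : ∃ t : ℝ, (0.112890385 < t ∧ t < 0.11289042) ∧ rootFun t = 0 ∧
    (∀ s : ℝ, -1 < s → rootFun s = 0 → s = t) ∧
    0.6426317 < Rinf t ∧ Rinf t < 0.6426318 := by
  have n1 := Real.log_two_gt_d9
  have n2 := Real.log_two_lt_d9
  have hlo : rootFun 0.112890385 < 0 := by
    rw [rootFun]; linarith [log_lower_bounds.2]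
  have hhi : 0 < rootFun 0.11289042 := by
    rw [rootFun]; linarith [log_upper_bounds.1]
  obtain ⟨t, ht, h0⟩ := intermediate_value_Ioo (f := rootFun) (a := 0.112890385) (b := 0.11289042)
    (by norm_num) (continuousOn_rootFun.mono fun x hx => by
      have := hx.1; norm_num at this ⊢; linarith) ⟨hlo, hhi⟩
  have t1 : 0.112890385 < t := ht.1
  have t2 : t < 0.11289042 := ht.2
  have tI : t ∈ Set.Icc (0 : ℝ) 1 := ⟨by norm_num at t1; linarith, by norm_num at t2; linarith⟩
  refine ⟨t, ⟨t1, t2⟩, h0, fun s hs hs0 => ?_, ?_, ?_⟩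
  · have hs1 : s ≤ 1 := by
      by_contra h
      have := rootFun_pos_of_one_le (not_le.1 h).le
      linarith
    exact rootFun_strictMonoOn.injOn ⟨hs, hs1⟩ ⟨by linarith [tI.1], tI.2⟩ (hs0.trans h0.symm)
  · refine lt_of_lt_of_le ?_ (rinf_antitoneOn tI (b := 0.11289042) (by norm_num) t2.le)
    rw [Rinf, Real.log_div two_ne_zero (by norm_num)]
    linarith [log_upper_bounds.2]
  · refine lt_of_le_of_lt (rinf_antitoneOn (a := 0.112890385) (by norm_num) tI t1.le) ?_
    rw [Rinf, Real.log_div two_ne_zero (by norm_num)]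
    linarith [log_lower_bounds.1]

/-! ### The integrals in the limit `k → ∞` -/

/-- `∫ (1 - min θ t) ^ N` over `θ ∈ [0, 1]`. -/
def alpha (t : ℝ) (N : ℕ) : ℝ := (∫ x in (0 : ℝ)..t, (1 - x) ^ N) + (1 - t) ^ (N + 1)

/-- `∫ (1 - θ + max (v - t) 0) ^ N` over `0 ≤ v ≤ θ ≤ 1`. -/
def beta (t : ℝ) (N : ℕ) : ℝ :=
  (∫ x in (0 : ℝ)..t, x * (1 - x) ^ N) + ∫ x in t..1, (1 + t - x) * (1 - x) ^ N

/-- `2 ^ (i + 1)` times the limit as `k → ∞` of the probability to select the `i`-th largest of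
the values (counted from `0`). -/
def selectWeight (t : ℝ) (i : ℕ) : ℝ :=
  (∫ x in (0 : ℝ)..t, (1 - x) ^ i / (1 + x)) + (1 - t) ^ (i + 1) -
    ∫ x in t..1, (1 + t - x) * (1 - x) ^ i / (1 + x)

/-- `2 ^ j` times the limit as `k → ∞` of the probability to select a value that is not among the
`j` largest ones. -/
def tailWeight (t : ℝ) (j : ℕ) : ℝ :=
  (∫ x in (0 : ℝ)..t, (1 - x) ^ j / (1 + x) ^ 2) + (1 - t) ^ (j + 1) / (1 + t) -
    ∫ x in t..1, (1 + t - x) * (1 - x) ^ j / (1 + x) ^ 2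

lemma intervalIntegrable_div_one_add_pow {f : ℝ → ℝ} (hf : Continuous f) {a b : ℝ} (ha : 0 ≤ a)
    (hb : 0 ≤ b) (n : ℕ) : IntervalIntegrable (fun x => f x / (1 + x) ^ n) volume a b := by
  refine ContinuousOn.intervalIntegrable (hf.continuousOn.div (by fun_prop) fun x hx => ?_)
  have : 0 ≤ x := (le_min ha hb).trans hx.1
  positivity

lemma intervalIntegrable_div_one_add {f : ℝ → ℝ} (hf : Continuous f) {a b : ℝ} (ha : 0 ≤ a)
    (hb : 0 ≤ b) : IntervalIntegrable (fun x => f x / (1 + x)) volume a b := by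
  simpa using intervalIntegrable_div_one_add_pow hf ha hb 1

/-- A truncated geometric series with ratio y/2. -/
lemma sum_half_pow_mul_le {y : ℝ} (h0 : 0 ≤ y) (h1 : y ≤ 1) (i M : ℕ) :
    ∑ r ∈ Finset.range M, (1 / 2) ^ (r + 1) * y ^ (i + r) ≤ y ^ i / (2 - y) := by
  have h2 : (2 - y) ≠ 0 := by linarith
  have e : ∑ r ∈ Finset.range M, (1 / 2) ^ (r + 1) * y ^ (i + r) =
      y ^ i / (2 - y) * (1 - (y / 2) ^ M) := by
    induction M with
    | zero => simp
    | succ M ih =>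
      rw [Finset.sum_range_succ, ih]
      simp only [div_pow, pow_succ, pow_add, one_pow]
      field_simp
      ring
  rw [e]
  exact mul_le_of_le_one_right (div_nonneg (by positivity) (by linarith))
    (by linarith [show 0 ≤ (y / 2) ^ M by positivity])

/-- The series of preemption probabilities is summed under the integral sign: with y = 1 - x the
geometric bound contributes the factor 1/(1 + x). Truncation at M only decreases the sum, as the
terms are non-negative. -/
lemma sum_beta_le {t : ℝ} (h0 : 0 ≤ t) (h1 : t ≤ 1) (i M : ℕ) :
    ∑ r ∈ Finset.range M, (1 / 2) ^ (r + 1) * beta t (i + r) ≤ alpha t i - selectWeight t i := by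
  have hsum (a b : ℝ) (g : ℝ → ℝ) (hg : Continuous g) :
      ∑ r ∈ Finset.range M, (1 / 2) ^ (r + 1) * (∫ x in a..b, g x * (1 - x) ^ (i + r)) =
        ∫ x in a..b, g x * ∑ r ∈ Finset.range M, (1 / 2) ^ (r + 1) * (1 - x) ^ (i + r) := by
    rw [← Finset.sum_congr rfl fun r _ => intervalIntegral.integral_const_mul _ _,
      ← intervalIntegral.integral_finsetSum fun r _ => Continuous.intervalIntegrable (by fun_prop) _ _]
    congr 1
    ext x
    rw [Finset.mul_sum]
    exact Finset.sum_congr rfl fun r _ => by ring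
  have hle (a b : ℝ) (ha : 0 ≤ a) (hab : a ≤ b) (hb : b ≤ 1) (g : ℝ → ℝ) (hg : Continuous g)
      (hg0 : ∀ x ∈ Set.Icc a b, 0 ≤ g x) :
      ∑ r ∈ Finset.range M, (1 / 2) ^ (r + 1) * (∫ x in a..b, g x * (1 - x) ^ (i + r)) ≤
        ∫ x in a..b, g x * (1 - x) ^ i / (1 + x) := by
    rw [hsum a b g hg]
    refine intervalIntegral.integral_mono_on hab (Continuous.intervalIntegrable (by fun_prop) _ _)
      (intervalIntegrable_div_one_add (by fun_prop) ha (ha.trans hab)) fun x hx => ?_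
    have := sum_half_pow_mul_le (y := 1 - x) (by linarith [hx.2]) (by linarith [hx.1]) i M
    rw [show 2 - (1 - x) = 1 + x by ring] at this
    rw [mul_div_assoc]
    exact mul_le_mul_of_nonneg_left this (hg0 x hx)
  have e : alpha t i - selectWeight t i = (∫ x in (0 : ℝ)..t, x * (1 - x) ^ i / (1 + x)) +
      ∫ x in t..1, (1 + t - x) * (1 - x) ^ i / (1 + x) := by
    have : (∫ x in (0 : ℝ)..t, x * (1 - x) ^ i / (1 + x)) =
        (∫ x in (0 : ℝ)..t, (1 - x) ^ i) - ∫ x in (0 : ℝ)..t, (1 - x) ^ i / (1 + x) := by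
      rw [← intervalIntegral.integral_sub (Continuous.intervalIntegrable (by fun_prop) _ _)
        (intervalIntegrable_div_one_add (by fun_prop) le_rfl h0)]
      refine intervalIntegral.integral_congr fun x hx => ?_
      rw [Set.uIcc_of_le h0] at hx
      have : 1 + x ≠ 0 := by linarith [hx.1]
      field_simp
      ring
    rw [this, alpha, selectWeight]
    ring
  rw [e]
  simp only [beta, mul_add, Finset.sum_add_distrib]
  exact add_le_add (hle 0 t le_rfl h0 h1 (fun x => x) (by fun_prop) fun x hx => hx.1)
    (hle t 1 h0 h1 le_rfl (fun x => 1 + t - x) (by fun_prop) fun x hx => by linarith [hx.2])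

/-- Since 2 (1 - x)^j - (1 - x)^(j+1) = (1 + x)(1 - x)^j, one factor 1 + x of the denominator
cancels. This makes the sum of the selection weights telescope. -/
lemma two_mul_tailWeight_sub {t : ℝ} (h0 : 0 ≤ t) (j : ℕ) :
    2 * tailWeight t j - tailWeight t (j + 1) = selectWeight t j := by
  have h (a b : ℝ) (ha : 0 ≤ a) (hb : 0 ≤ b) (g : ℝ → ℝ) (hg : Continuous g) :
      2 * (∫ x in a..b, g x * (1 - x) ^ j / (1 + x) ^ 2) -
        (∫ x in a..b, g x * (1 - x) ^ (j + 1) / (1 + x) ^ 2) =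
        ∫ x in a..b, g x * (1 - x) ^ j / (1 + x) := by
    rw [← intervalIntegral.integral_const_mul, ← intervalIntegral.integral_sub
      ((intervalIntegrable_div_one_add_pow (by fun_prop) ha hb 2).const_mul 2)
      (intervalIntegrable_div_one_add_pow (by fun_prop) ha hb 2)]
    refine intervalIntegral.integral_congr fun x hx => ?_
    have : 0 ≤ x := (le_min ha hb).trans hx.1
    have : 1 + x ≠ 0 := by linarith
    field_simp
    ring
  have i1 := h 0 t le_rfl h0 (fun _ => 1) (by fun_prop)
  have i2 := h t 1 h0 zero_le_one (fun x => 1 + t - x) (by fun_prop)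
  simp only [one_mul] at i1
  have i3 : 2 * ((1 - t) ^ (j + 1) / (1 + t)) - (1 - t) ^ (j + 1 + 1) / (1 + t) =
      (1 - t) ^ (j + 1) := by
    have : 1 + t ≠ 0 := by linarith
    field_simp
    ring
  rw [tailWeight, tailWeight, selectWeight, ← i1, ← i2]
  linarith

lemma sum_selectWeight {t : ℝ} (h0 : 0 ≤ t) (j : ℕ) :
    ∑ i ∈ Finset.range j, (1 / 2) ^ (i + 1) * selectWeight t i =
      tailWeight t 0 - (1 / 2) ^ j * tailWeight t j := by
  induction j with
  | zero => simp
  | succ j ih =>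
    rw [Finset.sum_range_succ, ih, ← two_mul_tailWeight_sub h0 j, pow_succ]
    ring

lemma integral_eq_sub_of_hasDerivAt_Icc {f f' : ℝ → ℝ} {a b : ℝ} (hab : a ≤ b)
    (h : ∀ x ∈ Set.Icc a b, HasDerivAt f (f' x) x) (hi : IntervalIntegrable f' volume a b) :
    ∫ x in a..b, f' x = f b - f a :=
  intervalIntegral.integral_eq_sub_of_hasDerivAt (by rwa [Set.uIcc_of_le hab]) hi

lemma hasDerivAt_log_one_add {x : ℝ} (hx : 0 ≤ x) :
    HasDerivAt (fun x : ℝ => Real.log (1 + x)) (1 / (1 + x)) x :=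
  ((hasDerivAt_id x).const_add 1).log (by simp; linarith)

lemma hasDerivAt_one_div_one_add {x : ℝ} (hx : 0 ≤ x) :
    HasDerivAt (fun x : ℝ => 1 / (1 + x)) (-1 / (1 + x) ^ 2) x := by
  simpa using ((hasDerivAt_id x).const_add 1).fun_inv (by simp; linarith)

lemma tailWeight_zero {t : ℝ} (h0 : 0 ≤ t) (h1 : t ≤ 1) : tailWeight t 0 = Rinf t := by
  have ht : 1 + t ≠ 0 := by linarith
  have i1 : ∫ x in (0 : ℝ)..t, 1 / (1 + x) ^ 2 = -(1 / (1 + t)) - -(1 / (1 + 0)) := by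
    refine integral_eq_sub_of_hasDerivAt_Icc (f := fun x => -(1 / (1 + x))) h0 (fun x hx => ?_)
      (intervalIntegrable_div_one_add_pow (by fun_prop) le_rfl h0 2)
    convert! (hasDerivAt_one_div_one_add hx.1).neg using 1
    ring
  have i2 : ∫ x in t..1, (1 + t - x) / (1 + x) ^ 2 =
      (-(2 + t) * (1 / (1 + 1)) - Real.log (1 + 1)) -
        (-(2 + t) * (1 / (1 + t)) - Real.log (1 + t)) := by
    refine integral_eq_sub_of_hasDerivAt_Icc
      (f := fun x => -(2 + t) * (1 / (1 + x)) - Real.log (1 + x)) h1 (fun x hx => ?_)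
      (intervalIntegrable_div_one_add_pow (by fun_prop) h0 zero_le_one 2)
    have hx0 : 0 ≤ x := h0.trans hx.1
    convert! ((hasDerivAt_one_div_one_add hx0).const_mul (-(2 + t))).sub
      (hasDerivAt_log_one_add hx0) using 1
    have : 1 + x ≠ 0 := by linarith
    field_simp
    ring
  simp only [tailWeight, pow_zero, mul_one, zero_add, pow_one]
  rw [i1, i2, Rinf, Real.log_div two_ne_zero ht, show (1 : ℝ) + 1 = 2 by norm_num]
  field_simp
  ring

/-- The origin of the equation: with `two_mul_tailWeight_sub` it gives T_1 = T_0 - `rootFun t`, so a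
root is exactly a t with T_1 = T_0. -/
lemma selectWeight_zero {t : ℝ} (h0 : 0 ≤ t) (h1 : t ≤ 1) :
    selectWeight t 0 = Rinf t + rootFun t := by
  have ht : 1 + t ≠ 0 := by linarith
  have i1 : ∫ x in (0 : ℝ)..t, 1 / (1 + x) = Real.log (1 + t) - Real.log (1 + 0) :=
    integral_eq_sub_of_hasDerivAt_Icc (f := fun x => Real.log (1 + x)) h0
      (fun x hx => hasDerivAt_log_one_add hx.1)
      (intervalIntegrable_div_one_add (by fun_prop) le_rfl h0)
  have i2 : ∫ x in t..1, (1 + t - x) / (1 + x) =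
      ((2 + t) * Real.log (1 + 1) - 1) - ((2 + t) * Real.log (1 + t) - t) := by
    refine integral_eq_sub_of_hasDerivAt_Icc
      (f := fun x => (2 + t) * Real.log (1 + x) - x) h1 (fun x hx => ?_)
      (intervalIntegrable_div_one_add (by fun_prop) h0 zero_le_one)
    have hx0 : 0 ≤ x := h0.trans hx.1
    convert! ((hasDerivAt_log_one_add hx0).const_mul (2 + t)).sub (hasDerivAt_id x) using 1
    have : 1 + x ≠ 0 := by linarith
    field_simp
    ring
  simp only [selectWeight, pow_zero, mul_one, zero_add, pow_one]
  rw [i1, i2, Rinf, Real.log_div two_ne_zero ht, rootFun, show (1 : ℝ) + 1 = 2 by norm_num]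
  simp
  ring

lemma integral_one_sub_pow (t : ℝ) (j : ℕ) :
    ∫ x in t..1, (1 - x) ^ j = (1 - t) ^ (j + 1) / (j + 1) := by
  rw [intervalIntegral.integral_comp_sub_left (fun x => x ^ j) 1, integral_pow]
  simp

/-- In the difference the integral over [0, t] is non-negative. In the one over [t, 1], x (1 + t -
x)/(1 + x)^2 ≤ 2t/(1 + t); integrating (1 - x)^j gives a factor 1/(j + 1) ≤ 1/2, so the boundary
term t (1 - t)^(j+1)/(1 + t) absorbs it. The factor 1/2 is where j ≥ 1 enters. -/
lemma tailWeight_succ_le {t : ℝ} (h0 : 0.11 < t) (h1 : t < 0.115) {j : ℕ} (hj : 1 ≤ j) :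
    tailWeight t (j + 1) ≤ tailWeight t j := by
  have ht0 : 0 ≤ t := by norm_num at h0; linarith
  have ht1 : t ≤ 1 := by norm_num at h1; linarith
  have htp : 0 < 1 + t := by linarith
  have h (a b : ℝ) (ha : 0 ≤ a) (hb : 0 ≤ b) (g : ℝ → ℝ) (hg : Continuous g) :
      (∫ x in a..b, g x * (1 - x) ^ j / (1 + x) ^ 2) -
        (∫ x in a..b, g x * (1 - x) ^ (j + 1) / (1 + x) ^ 2) =
        ∫ x in a..b, x * g x * (1 - x) ^ j / (1 + x) ^ 2 := by
    rw [← intervalIntegral.integral_sub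
      (intervalIntegrable_div_one_add_pow (by fun_prop) ha hb 2)
      (intervalIntegrable_div_one_add_pow (by fun_prop) ha hb 2)]
    refine intervalIntegral.integral_congr fun x hx => ?_
    ring
  have i1 := h 0 t le_rfl ht0 (fun _ => 1) (by fun_prop)
  have i2 := h t 1 ht0 zero_le_one (fun x => 1 + t - x) (by fun_prop)
  simp only [one_mul, mul_one] at i1
  have n1 : 0 ≤ ∫ x in (0 : ℝ)..t, x * (1 - x) ^ j / (1 + x) ^ 2 := by
    refine intervalIntegral.integral_nonneg ht0 fun x hx => ?_
    have : 0 ≤ 1 - x := by linarith [hx.2]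
    have := hx.1
    positivity
  have n2 : (∫ x in t..1, x * (1 + t - x) * (1 - x) ^ j / (1 + x) ^ 2) ≤
      t * (1 - t) ^ (j + 1) / (1 + t) := by
    have e : (∫ x in t..1, 2 * t / (1 + t) * (1 - x) ^ j) ≤ t * (1 - t) ^ (j + 1) / (1 + t) := by
      rw [intervalIntegral.integral_const_mul, integral_one_sub_pow]
      have hj' : (2 : ℝ) ≤ j + 1 := by
        have : (1 : ℝ) ≤ j := by exact_mod_cast hj
        linarith
      have : (1 - t) ^ (j + 1) / (j + 1) ≤ (1 - t) ^ (j + 1) / 2 :=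
        div_le_div_of_nonneg_left (pow_nonneg (by linarith) _) two_pos hj'
      calc _ ≤ 2 * t / (1 + t) * ((1 - t) ^ (j + 1) / 2) :=
            mul_le_mul_of_nonneg_left this (by positivity)
        _ = _ := by ring
    refine le_trans (intervalIntegral.integral_mono_on ht1
      (intervalIntegrable_div_one_add_pow (by fun_prop) ht0 zero_le_one 2)
      (Continuous.intervalIntegrable (by fun_prop) _ _) fun x hx => ?_) e
    have hx0 : 0 ≤ x := ht0.trans hx.1
    have hy : 0 ≤ (1 - x) ^ j := pow_nonneg (by linarith [hx.2]) _
    rw [mul_div_right_comm]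
    refine mul_le_mul_of_nonneg_right ?_ hy
    rw [div_le_div_iff₀ (by positivity) htp]
    norm_num at h0 h1
    -- 0.297 is close to the minimizer in x of the quadratic 2t (1 + x)^2 - (1 + t) x (1 + t - x).
    nlinarith [sq_nonneg (x - 0.297), mul_nonneg hx0 hx0, mul_nonneg hx0 (sub_nonneg.2 h0.le),
      mul_nonneg hx0 (sub_nonneg.2 h1.le), mul_nonneg (mul_nonneg hx0 hx0) (sub_nonneg.2 h0.le)]
  have i3 : (1 - t) ^ (j + 1) / (1 + t) - (1 - t) ^ (j + 1 + 1) / (1 + t) =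
      t * (1 - t) ^ (j + 1) / (1 + t) := by ring
  rw [tailWeight, tailWeight]
  linarith

/-- At the root of the equation, the values that are not among the `j` largest ones do not get more
than their share. -/
lemma le_sum_selectWeight {t : ℝ} (h0 : 0.11 < t) (h1 : t < 0.115) (hr : rootFun t = 0) (j : ℕ) :
    Rinf t * (1 - (1 / 2) ^ j) ≤ ∑ i ∈ Finset.range j, (1 / 2) ^ (i + 1) * selectWeight t i := by
  have ht0 : 0 ≤ t := by norm_num at h0; linarith
  have ht1 : t ≤ 1 := by norm_num at h1; linarith
  have e0 := tailWeight_zero ht0 ht1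
  have hT : ∀ j, tailWeight t j ≤ Rinf t := by
    intro j
    induction j with
    | zero => exact e0.le
    | succ j ih =>
      rcases Nat.eq_zero_or_pos j with rfl | hj
      · have := two_mul_tailWeight_sub ht0 0
        rw [selectWeight_zero ht0 ht1] at this
        linarith
      · exact (tailWeight_succ_le h0 h1 hj).trans ih
  rw [sum_selectWeight ht0, e0]
  have := mul_le_mul_of_nonneg_left (hT j) (show (0 : ℝ) ≤ (1 / 2) ^ j by positivity)
  linarith

open ProbabilityTheory ENNReal

/-! ### Independent arrival times -/

lemma integral_one_sub_min_pow {t : ℝ} (h0 : 0 ≤ t) (h1 : t ≤ 1) (N : ℕ) :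
    ∫ x in (0 : ℝ)..1, (1 - min x t) ^ N = alpha t N := by
  rw [← intervalIntegral.integral_add_adjacent_intervals (b := t)
    (Continuous.intervalIntegrable (by fun_prop) _ _)
    (Continuous.intervalIntegrable (by fun_prop) _ _), alpha]
  congr 1
  · refine intervalIntegral.integral_congr fun x hx => ?_
    rw [Set.uIcc_of_le h0] at hx
    simp only [min_eq_left hx.2]
  · have : ∫ x in t..1, (1 - min x t) ^ N = ∫ x in t..1, (1 - t) ^ N := by
      refine intervalIntegral.integral_congr fun x hx => ?_
      rw [Set.uIcc_of_le h1] at hx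
      simp only [min_eq_right hx.1]
    rw [this, intervalIntegral.integral_const, smul_eq_mul, pow_succ']

/-- For u > t the inner integral differs from the integrand of `beta`; they agree only after
integration over u, because ((1 - t)^(N+1) - (1 - u)^(N+1))/(N + 1) and (1 - u)^(N+1) have the same
integral over [t, 1]. -/
lemma integral_integral_pow {t : ℝ} (h0 : 0 ≤ t) (h1 : t ≤ 1) (N : ℕ) :
    ∫ u in (0 : ℝ)..1, ∫ v in (0 : ℝ)..u, (1 - u + max (v - t) 0) ^ N = beta t N := by
  have hc : Continuous fun u : ℝ => ∫ v in (0 : ℝ)..u, (1 - u + max (v - t) 0) ^ N :=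
    intervalIntegral.continuous_parametric_intervalIntegral_of_continuous
      (f := fun u v : ℝ => (1 - u + max (v - t) 0) ^ N) (by fun_prop) continuous_id
  rw [← intervalIntegral.integral_add_adjacent_intervals (b := t)
    (hc.intervalIntegrable _ _) (hc.intervalIntegrable _ _), beta]
  have small (u w : ℝ) (hw0 : 0 ≤ w) (hw : w ≤ t) :
      ∫ v in (0 : ℝ)..w, (1 - u + max (v - t) 0) ^ N = w * (1 - u) ^ N := by
    have : ∫ v in (0 : ℝ)..w, (1 - u + max (v - t) 0) ^ N = ∫ v in (0 : ℝ)..w, (1 - u) ^ N := by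
      refine intervalIntegral.integral_congr fun v hv => ?_
      rw [Set.uIcc_of_le hw0] at hv
      simp only [max_eq_right (show v - t ≤ 0 by linarith [hv.2]), add_zero]
    rw [this, intervalIntegral.integral_const, smul_eq_mul, sub_zero]
  congr 1
  · refine intervalIntegral.integral_congr fun u hu => ?_
    rw [Set.uIcc_of_le h0] at hu
    exact small u u hu.1 hu.2
  · have hN : (N : ℝ) + 1 ≠ 0 := by positivity
    have hN' : (N : ℝ) + 1 + 1 ≠ 0 := by positivity
    have inner : ∫ u in t..1, ∫ v in (0 : ℝ)..u, (1 - u + max (v - t) 0) ^ N =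
        ∫ u in t..1, (t * (1 - u) ^ N + ((1 - t) ^ (N + 1) / (N + 1) -
          (1 / (N + 1)) * (1 - u) ^ (N + 1))) := by
      refine intervalIntegral.integral_congr fun u hu => ?_
      rw [Set.uIcc_of_le h1] at hu
      rw [← intervalIntegral.integral_add_adjacent_intervals (b := t)
        (Continuous.intervalIntegrable (by fun_prop) _ _)
        (Continuous.intervalIntegrable (by fun_prop) _ _), small u t h0 le_rfl]
      congr 1
      have : ∫ v in t..u, (1 - u + max (v - t) 0) ^ N =
          ∫ v in t..u, (fun x => x ^ N) (v + (1 - u - t)) := by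
        refine intervalIntegral.integral_congr fun v hv => ?_
        rw [Set.uIcc_of_le hu.1] at hv
        simp only [max_eq_left (show 0 ≤ v - t by linarith [hv.1])]
        ring
      rw [this, intervalIntegral.integral_comp_add_right (fun x => x ^ N), integral_pow]
      rw [show u + (1 - u - t) = 1 - t by ring, show t + (1 - u - t) = 1 - u by ring]
      ring
    have outer : ∫ u in t..1, (1 + t - u) * (1 - u) ^ N =
        ∫ u in t..1, (t * (1 - u) ^ N + (1 - u) ^ (N + 1)) :=
      intervalIntegral.integral_congr fun u _ => by ring
    rw [inner, outer, intervalIntegral.integral_add (Continuous.intervalIntegrable (by fun_prop) _ _)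
      (Continuous.intervalIntegrable (by fun_prop) _ _),
      intervalIntegral.integral_add (Continuous.intervalIntegrable (by fun_prop) _ _)
      (Continuous.intervalIntegrable (by fun_prop) _ _),
      intervalIntegral.integral_sub (Continuous.intervalIntegrable (by fun_prop) _ _)
      (Continuous.intervalIntegrable (by fun_prop) _ _), intervalIntegral.integral_const_mul,
      intervalIntegral.integral_const_mul, intervalIntegral.integral_const, integral_one_sub_pow,
      integral_one_sub_pow]
    push_cast
    rw [smul_eq_mul]
    field_simp
    ring

/-- The law of the arrival time of a value: uniform on `[-1, 1]`. -/
def arrivalLaw : Measure ℝ := (2⁻¹ : ℝ≥0∞) • volume.restrict (Set.Icc (-1) 1)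

lemma arrivalLaw_Ico {a b : ℝ} (ha : -1 ≤ a) (hb : b ≤ 1) :
    arrivalLaw (Set.Ico a b) = ENNReal.ofReal ((b - a) / 2) := by
  have : Set.Ico a b ∩ Set.Icc (-1) 1 = Set.Ico a b :=
    Set.inter_eq_left.2 fun x hx => ⟨ha.trans hx.1, hx.2.le.trans hb⟩
  rw [arrivalLaw, Measure.smul_apply, Measure.restrict_apply measurableSet_Ico, this,
    Real.volume_Ico, smul_eq_mul, mul_comm, ENNReal.ofReal_div_of_pos two_pos, div_eq_mul_inv]
  norm_num

instance : IsProbabilityMeasure arrivalLaw where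
  measure_univ := by
    rw [arrivalLaw, Measure.smul_apply, Measure.restrict_apply_univ, Real.volume_Icc, smul_eq_mul]
    norm_num
    exact ENNReal.inv_mul_cancel (by norm_num) (by norm_num)

instance : NullSingletonClass arrivalLaw where
  measure_singleton x := by
    rw [arrivalLaw, Measure.smul_apply, measure_singleton, smul_zero]

lemma arrivalLaw_compl_Ico {a b : ℝ} (ha : -1 ≤ a) (hab : a ≤ b) (hb : b ≤ 1) :
    arrivalLaw (Set.Ico a b)ᶜ = ENNReal.ofReal ((2 - (b - a)) / 2) := by
  rw [prob_compl_eq_one_sub measurableSet_Ico, arrivalLaw_Ico ha hb, ← ENNReal.ofReal_one,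
    ← ENNReal.ofReal_sub _ (by linarith)]
  congr 1
  ring

lemma setLIntegral_arrivalLaw_Ici (f : ℝ → ℝ≥0∞) :
    ∫⁻ x in Set.Ici 0, f x ∂arrivalLaw = 2⁻¹ * ∫⁻ x in Set.Ioc 0 1, f x := by
  rw [arrivalLaw, Measure.restrict_smul, lintegral_smul_measure,
    Measure.restrict_restrict measurableSet_Ici, smul_eq_mul, restrict_Ioc_eq_restrict_Icc]
  congr 3
  ext x
  simp only [Set.mem_inter_iff, Set.mem_Ici, Set.mem_Icc]
  constructor
  · rintro ⟨h1, h2, h3⟩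
    exact ⟨h1, h3⟩
  · rintro ⟨h1, h2⟩
    exact ⟨h1, by linarith, h2⟩

lemma setLIntegral_Ioc_ofReal {f : ℝ → ℝ} (hf : Continuous f) {a b : ℝ} (hab : a ≤ b)
    (h0 : ∀ x ∈ Set.Ioc a b, 0 ≤ f x) :
    ∫⁻ x in Set.Ioc a b, ENNReal.ofReal (f x) = ENNReal.ofReal (∫ x in a..b, f x) := by
  rw [intervalIntegral.integral_of_le hab, ofReal_integral_eq_lintegral_ofReal
    (hf.integrableOn_Ioc) ((ae_restrict_iff' measurableSet_Ioc).2 (ae_of_all _ h0))]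

lemma two_inv_mul_ofReal (x : ℝ) : 2⁻¹ * ENNReal.ofReal x = ENNReal.ofReal (1 / 2 * x) := by
  rw [ENNReal.ofReal_mul (by norm_num), one_div, ENNReal.ofReal_inv_of_pos two_pos]
  norm_num

section Independent

variable {Ω : Type*} [MeasurableSpace Ω] {μ : Measure Ω} [IsProbabilityMeasure μ]
  {ι : Type*} {Z : ι → Ω → ℝ}

/-- Fubini after conditioning on W: given W = p, the remaining variables are iid with law ν, and
each of them has to fall into the fibre of A over p. -/
lemma measure_forall_mem_of_indepFun {E : Type*} [MeasurableSpace E] {ν : Measure ℝ}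
    [IsProbabilityMeasure ν] (hZ : iIndepFun Z μ)
    (hm : ∀ i, Measurable (Z i)) (hlaw : ∀ i, μ.map (Z i) = ν) {W : Ω → E} (hW : Measurable W)
    (s : Finset ι) (hind : IndepFun W (fun ω (r : s) => Z r ω) μ) {B : Set E}
    (hB : MeasurableSet B) {A : Set (E × ℝ)} (hA : MeasurableSet A) :
    μ {ω | W ω ∈ B ∧ ∀ r ∈ s, (W ω, Z r ω) ∈ A} =
      ∫⁻ p in B, ν (Prod.mk p ⁻¹' A) ^ s.card ∂(μ.map W) := by
  have hV : Measurable fun ω (r : s) => Z r ω := measurable_pi_lambda _ fun r => hm r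
  have hlawV : μ.map (fun ω (r : s) => Z r ω) = Measure.pi fun _ : s => ν := by
    have h1 : iIndepFun (fun r : s => Z r) μ := hZ.precomp Subtype.val_injective
    rw [(iIndepFun_iff_map_fun_eq_pi_map fun r : s => (hm r).aemeasurable).1 h1]
    simp only [hlaw]
  set C : Set (E × (s → ℝ)) := {p | p.1 ∈ B ∧ ∀ r, (p.1, p.2 r) ∈ A} with hC
  have hCm : MeasurableSet C := by
    rw [hC, Set.ofPred_and, Set.ofPred_forall]
    refine (measurable_fst hB).inter ?_
    exact MeasurableSet.iInter fun r => (by fun_prop : Measurable fun p : E × (s → ℝ) =>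
      (p.1, p.2 r)) hA
  have e : {ω | W ω ∈ B ∧ ∀ r ∈ s, (W ω, Z r ω) ∈ A} =
      (fun ω => (W ω, fun r : s => Z r ω)) ⁻¹' C := by
    ext ω
    simp [hC]
  have : IsProbabilityMeasure (μ.map W) := Measure.isProbabilityMeasure_map hW.aemeasurable
  rw [e, ← Measure.map_apply (hW.prodMk hV) hCm,
    (indepFun_iff_map_prod_eq_prod_map_map hW.aemeasurable hV.aemeasurable).1 hind, hlawV,
    Measure.prod_apply hCm, ← lintegral_indicator hB]
  refine lintegral_congr fun p => ?_
  by_cases hp : p ∈ B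
  · have : Prod.mk p ⁻¹' C = Set.univ.pi fun _ : s => Prod.mk p ⁻¹' A := by
      ext v
      simp [hC, hp]
    rw [Set.indicator_of_mem hp, this, Measure.pi_pi]
    simp
  · have : Prod.mk p ⁻¹' C = ∅ := by
      ext v
      simp [hC, hp]
    rw [Set.indicator_of_notMem hp, this, measure_empty]

lemma measure_forall_mem_one [DecidableEq ι] {ν : Measure ℝ} [IsProbabilityMeasure ν]
    (hZ : iIndepFun Z μ)
    (hm : ∀ i, Measurable (Z i)) (hlaw : ∀ i, μ.map (Z i) = ν) {i : ι} {s : Finset ι}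
    (his : i ∉ s) {B : Set ℝ} (hB : MeasurableSet B) {A : Set (ℝ × ℝ)} (hA : MeasurableSet A) :
    μ {ω | Z i ω ∈ B ∧ ∀ r ∈ s, (Z i ω, Z r ω) ∈ A} =
      ∫⁻ p in B, ν (Prod.mk p ⁻¹' A) ^ s.card ∂ν := by
  have h1 := hZ.indepFun_finset {i} s (by simpa using his) hm
  have hφ : Measurable fun v : ({i} : Finset ι) → ℝ => v ⟨i, Finset.mem_singleton_self i⟩ :=
    measurable_pi_apply _
  have h2 : IndepFun (Z i) (fun ω (r : s) => Z r ω) μ := h1.comp hφ measurable_id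
  rw [measure_forall_mem_of_indepFun hZ hm hlaw (hm i) s h2 hB hA, hlaw]

lemma measure_forall_mem_two [DecidableEq ι] {ν : Measure ℝ} [IsProbabilityMeasure ν]
    (hZ : iIndepFun Z μ)
    (hm : ∀ i, Measurable (Z i)) (hlaw : ∀ i, μ.map (Z i) = ν) {i l : ι} (hil : i ≠ l)
    {s : Finset ι} (his : i ∉ s) (hls : l ∉ s) {B : Set (ℝ × ℝ)} (hB : MeasurableSet B)
    {A : Set ((ℝ × ℝ) × ℝ)} (hA : MeasurableSet A) :
    μ {ω | (Z i ω, Z l ω) ∈ B ∧ ∀ r ∈ s, ((Z i ω, Z l ω), Z r ω) ∈ A} =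
      ∫⁻ p in B, ν (Prod.mk p ⁻¹' A) ^ s.card ∂(ν.prod ν) := by
  have h1 := hZ.indepFun_finset {i, l} s (by simp [his, hls]) hm
  have h2 : IndepFun (fun ω => (Z i ω, Z l ω)) (fun ω (r : s) => Z r ω) μ :=
    h1.comp (φ := fun v => (v ⟨i, Finset.mem_insert_self i {l}⟩,
        v ⟨l, Finset.mem_insert_of_mem (Finset.mem_singleton_self l)⟩)) (ψ := id)
      ((measurable_pi_apply _).prodMk (measurable_pi_apply _)) measurable_id
  rw [measure_forall_mem_of_indepFun hZ hm hlaw ((hm i).prodMk (hm l)) s h2 hB hA,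
    (indepFun_iff_map_prod_eq_prod_map_map (hm i).aemeasurable (hm l).aemeasurable).1
      (hZ.indepFun hil), hlaw, hlaw]

end Independent

/-! ### The events that decide which value is selected -/

/-- The `i`-th largest of the values, arriving at times `z`, is hidden and acceptable. -/
def Acceptable {m : ℕ} (t : ℝ) (z : Fin m → ℝ) (i : Fin m) : Prop :=
  0 ≤ z i ∧ ∀ r < i, z r ∉ Set.Ico (max (z i - 1 - t) (-1)) (z i)

/-- The `l`-th value is the largest hidden one before the `i`-th value, and it is acceptable
when the latter is ignored. -/
def Preempts {m : ℕ} (t : ℝ) (z : Fin m → ℝ) (i l : Fin m) : Prop :=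
  (0 ≤ z l ∧ z l ≤ z i) ∧ ∀ r < l, r ≠ i → z r ∉ Set.Ico (max (z l - 1 - t) (-1)) (z i)

/-- None of the other `m` largest values arrives in the window of the `i`-th one or is hidden and
arrives before it. -/
def Isolated {m : ℕ} (t : ℝ) (z : Fin m → ℝ) (i : Fin m) : Prop :=
  0 ≤ z i ∧ ∀ r ≠ i, z r ∉ Set.Ico (max (z i - 1 - t) (-1)) (z i)

section Events

variable {Ω : Type*} [MeasurableSpace Ω] {μ : Measure Ω} [IsProbabilityMeasure μ]
  {m : ℕ} {Z : Fin m → Ω → ℝ}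

lemma measurableSet_window_compl (t : ℝ) :
    MeasurableSet {p : ℝ × ℝ | p.2 ∉ Set.Ico (max (p.1 - 1 - t) (-1)) p.1} := by
  simp only [Set.mem_Ico]
  measurability

/-- The window of an arrival at x ≥ 0 has length 1 + min x t, out of a total of 2. -/
lemma arrivalLaw_window_compl {t x : ℝ} (h0 : 0 ≤ t) (hx0 : 0 ≤ x) (hx1 : x ≤ 1) :
    arrivalLaw (Prod.mk x ⁻¹' {p : ℝ × ℝ | p.2 ∉ Set.Ico (max (p.1 - 1 - t) (-1)) p.1}) =
      ENNReal.ofReal ((1 - min x t) / 2) := by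
  have : Prod.mk x ⁻¹' {p : ℝ × ℝ | p.2 ∉ Set.Ico (max (p.1 - 1 - t) (-1)) p.1} =
      (Set.Ico (max (x - 1 - t) (-1)) x)ᶜ := rfl
  rw [this, arrivalLaw_compl_Ico (le_max_right _ _) (max_le (by linarith) (by linarith)) hx1]
  congr 2
  rcases le_total x t with h | h
  · rw [max_eq_right (by linarith), min_eq_left h]
    ring
  · rw [max_eq_left (by linarith), min_eq_right h]
    ring

lemma measure_window_compl {t : ℝ} (h0 : 0 ≤ t) (h1 : t ≤ 1) (hZ : iIndepFun Z μ)
    (hm : ∀ i, Measurable (Z i)) (hlaw : ∀ i, μ.map (Z i) = arrivalLaw) (i : Fin m)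
    (s : Finset (Fin m)) (his : i ∉ s) :
    μ {ω | 0 ≤ Z i ω ∧ ∀ r ∈ s, Z r ω ∉ Set.Ico (max (Z i ω - 1 - t) (-1)) (Z i ω)} =
      ENNReal.ofReal ((1 / 2) ^ (s.card + 1) * alpha t s.card) := by
  have := measure_forall_mem_one hZ hm hlaw his measurableSet_Ici (measurableSet_window_compl t)
    (B := Set.Ici 0)
  simp only [Set.mem_Ici, Set.mem_ofPred_eq] at this
  rw [this, setLIntegral_arrivalLaw_Ici]
  have e : ∫⁻ x in Set.Ioc (0 : ℝ) 1, arrivalLaw (Prod.mk x ⁻¹'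
      {p : ℝ × ℝ | p.2 ∉ Set.Ico (max (p.1 - 1 - t) (-1)) p.1}) ^ s.card =
      ∫⁻ x in Set.Ioc (0 : ℝ) 1, ENNReal.ofReal (((1 - min x t) / 2) ^ s.card) := by
    refine setLIntegral_congr_fun measurableSet_Ioc fun x hx => ?_
    rw [arrivalLaw_window_compl h0 hx.1.le hx.2, ENNReal.ofReal_pow]
    linarith [min_le_left x t, hx.2]
  rw [e, setLIntegral_Ioc_ofReal (by fun_prop) zero_le_one fun x hx =>
    pow_nonneg (by linarith [min_le_left x t, hx.2]) _, two_inv_mul_ofReal]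
  simp only [div_pow]
  rw [intervalIntegral.integral_div, integral_one_sub_min_pow h0 h1]
  congr 1
  rw [one_pow, pow_succ]
  field_simp

lemma measure_acceptable {t : ℝ} (h0 : 0 ≤ t) (h1 : t ≤ 1) (hZ : iIndepFun Z μ)
    (hm : ∀ i, Measurable (Z i)) (hlaw : ∀ i, μ.map (Z i) = arrivalLaw) (i : Fin m) :
    μ {ω | Acceptable t (fun r => Z r ω) i} =
      ENNReal.ofReal ((1 / 2) ^ (i.val + 1) * alpha t i) := by
  have := measure_window_compl h0 h1 hZ hm hlaw i (Finset.Iio i) (by simp)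
  simpa only [Acceptable, Finset.mem_Iio, Fin.card_Iio] using this

lemma alpha_le_one {t : ℝ} (h0 : 0 ≤ t) (h1 : t ≤ 1) (N : ℕ) : alpha t N ≤ 1 := by
  rw [← integral_one_sub_min_pow h0 h1]
  calc ∫ x in (0 : ℝ)..1, (1 - min x t) ^ N ≤ ∫ x in (0 : ℝ)..1, 1 := by
        refine intervalIntegral.integral_mono_on zero_le_one
          (Continuous.intervalIntegrable (by fun_prop) _ _)
          (Continuous.intervalIntegrable (by fun_prop) _ _) fun x hx => ?_
        exact pow_le_one₀ (by linarith [min_le_left x t, hx.2]) (by linarith [le_min hx.1 h0])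
    _ = 1 := by simp

lemma measure_isolated_le {t : ℝ} (h0 : 0 ≤ t) (h1 : t ≤ 1) (hZ : iIndepFun Z μ)
    (hm : ∀ i, Measurable (Z i)) (hlaw : ∀ i, μ.map (Z i) = arrivalLaw) (i : Fin m) :
    μ {ω | Isolated t (fun r => Z r ω) i} ≤ ENNReal.ofReal ((1 / 2) ^ m) := by
  have := measure_window_compl h0 h1 hZ hm hlaw i (Finset.univ.erase i) (by simp)
  rw [Finset.card_erase_of_mem (Finset.mem_univ _), Finset.card_univ, Fintype.card_fin,
    Nat.sub_add_cancel (by have := i.2; omega)] at this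
  simp only [Finset.mem_erase, Finset.mem_univ, and_true] at this
  refine le_trans this.le (ENNReal.ofReal_le_ofReal ?_)
  exact mul_le_of_le_one_right (by positivity) (alpha_le_one h0 h1 _)

/-- Given times v ≤ u of the l-th and i-th values, the other l - 1 values above the l-th must avoid
an interval whose complement has length 1 - u + max (v - t) 0. Each of them contributes a factor 1/2
from the density, and the two integrations over hidden times contribute two more. -/
lemma measure_preempts {t : ℝ} (h0 : 0 ≤ t) (h1 : t ≤ 1) (hZ : iIndepFun Z μ)
    (hm : ∀ i, Measurable (Z i)) (hlaw : ∀ i, μ.map (Z i) = arrivalLaw) {i l : Fin m}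
    (hil : i < l) :
    μ {ω | Preempts t (fun r => Z r ω) i l} =
      ENNReal.ofReal ((1 / 2) ^ (l.val + 1) * beta t (l - 1)) := by
  have hB : MeasurableSet {p : ℝ × ℝ | 0 ≤ p.2 ∧ p.2 ≤ p.1} := by measurability
  have hA : MeasurableSet
      {p : (ℝ × ℝ) × ℝ | p.2 ∉ Set.Ico (max (p.1.2 - 1 - t) (-1)) p.1.1} := by
    simp only [Set.mem_Ico]
    measurability
  have hcard : ((Finset.Iio l).erase i).card = l - 1 := by
    rw [Finset.card_erase_of_mem (Finset.mem_Iio.2 hil), Fin.card_Iio]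
  have := measure_forall_mem_two hZ hm hlaw hil.ne (s := (Finset.Iio l).erase i) (by simp)
    (by simp) hB hA
  have e : {ω | Preempts t (fun r => Z r ω) i l} = {ω | (Z i ω, Z l ω) ∈
      {p : ℝ × ℝ | 0 ≤ p.2 ∧ p.2 ≤ p.1} ∧ ∀ r ∈ (Finset.Iio l).erase i,
      ((Z i ω, Z l ω), Z r ω) ∈
        {p : (ℝ × ℝ) × ℝ | p.2 ∉ Set.Ico (max (p.1.2 - 1 - t) (-1)) p.1.1}} := by
    ext ω
    simp only [Preempts, Set.mem_ofPred_eq, Finset.mem_erase, Finset.mem_Iio, and_imp]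
    exact and_congr_right fun _ => ⟨fun h r h1 h2 => h r h2 h1, fun h r h1 h2 => h r h2 h1⟩
  rw [e, this, hcard, ← lintegral_indicator hB,
    lintegral_prod _ (Measurable.aemeasurable
      (((measurable_measure_prodMk_left hA).pow_const _).indicator hB))]
  set N := l.val - 1 with hN
  set A := {p : (ℝ × ℝ) × ℝ | p.2 ∉ Set.Ico (max (p.1.2 - 1 - t) (-1)) p.1.1} with hAdef
  have hval (u v : ℝ) (hv : 0 ≤ v) (hvu : v ≤ u) (hu : u ≤ 1) :
      arrivalLaw (Prod.mk (u, v) ⁻¹' A) = ENNReal.ofReal ((1 - u + max (v - t) 0) / 2) := by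
    have : Prod.mk (u, v) ⁻¹' A = (Set.Ico (max (v - 1 - t) (-1)) u)ᶜ := rfl
    rw [this, arrivalLaw_compl_Ico (le_max_right _ _) (max_le (by linarith) (by linarith)) hu]
    congr 2
    rcases le_total v t with h | h
    · rw [max_eq_right (by linarith), max_eq_right (by linarith)]
      ring
    · rw [max_eq_left (by linarith), max_eq_left (by linarith)]
      ring
  have inner (u : ℝ) : ∫⁻ v, Set.indicator {p : ℝ × ℝ | 0 ≤ p.2 ∧ p.2 ≤ p.1}
      (fun p => arrivalLaw (Prod.mk p ⁻¹' A) ^ N) (u, v) ∂arrivalLaw =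
      Set.indicator (Set.Ici 0) (fun u => ∫⁻ v in Set.Ici 0, Set.indicator (Set.Iic u)
      (fun v => arrivalLaw (Prod.mk (u, v) ⁻¹' A) ^ N) v ∂arrivalLaw) u := by
    by_cases hu : 0 ≤ u
    · rw [Set.indicator_of_mem (Set.mem_Ici.2 hu), ← lintegral_indicator measurableSet_Ici]
      refine lintegral_congr fun v => ?_
      simp only [Set.indicator_apply, Set.mem_ofPred_eq, Set.mem_Ici, Set.mem_Iic]
      split_ifs <;> simp_all
    · rw [Set.indicator_of_notMem (mt Set.mem_Ici.1 hu)]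
      refine lintegral_eq_zero_of_ae_eq_zero (ae_of_all _ fun v => ?_)
      refine Set.indicator_of_notMem ?_ _
      rintro ⟨h1, h2⟩
      exact hu (h1.trans h2)
  simp only [inner]
  rw [lintegral_indicator measurableSet_Ici, setLIntegral_arrivalLaw_Ici]
  have hcont : Continuous fun u : ℝ =>
      ∫ v in (0 : ℝ)..u, ((1 - u + max (v - t) 0) / 2) ^ N :=
    intervalIntegral.continuous_parametric_intervalIntegral_of_continuous
      (f := fun u v : ℝ => ((1 - u + max (v - t) 0) / 2) ^ N) (by fun_prop) continuous_id
  have hnn (u v : ℝ) (hu : u ≤ 1) : 0 ≤ ((1 - u + max (v - t) 0) / 2) ^ N :=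
    pow_nonneg (by linarith [le_max_right (v - t) 0]) _
  have e2 : ∫⁻ u in Set.Ioc (0 : ℝ) 1, ∫⁻ v in Set.Ici 0, Set.indicator (Set.Iic u)
      (fun v => arrivalLaw (Prod.mk (u, v) ⁻¹' A) ^ N) v ∂arrivalLaw =
      ∫⁻ u in Set.Ioc (0 : ℝ) 1, ENNReal.ofReal (1 / 2 *
        ∫ v in (0 : ℝ)..u, ((1 - u + max (v - t) 0) / 2) ^ N) := by
    refine setLIntegral_congr_fun measurableSet_Ioc fun u hu => ?_
    rw [setLIntegral_arrivalLaw_Ici, setLIntegral_indicator measurableSet_Iic,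
      show Set.Iic u ∩ Set.Ioc 0 1 = Set.Ioc 0 u by
        ext v
        simp only [Set.mem_inter_iff, Set.mem_Iic, Set.mem_Ioc]
        exact ⟨fun h => ⟨h.2.1, h.1⟩, fun h => ⟨h.2, h.1, h.2.trans hu.2⟩⟩,
      ← two_inv_mul_ofReal, ← setLIntegral_Ioc_ofReal (by fun_prop) hu.1.le
        fun v _ => hnn u v hu.2]
    congr 1
    refine setLIntegral_congr_fun measurableSet_Ioc fun v hv => ?_
    rw [hval u v hv.1.le hv.2 hu.2, ENNReal.ofReal_pow]
    linarith [le_max_right (v - t) 0, hu.2]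
  rw [e2, setLIntegral_Ioc_ofReal (hcont.const_mul _) zero_le_one fun u hu =>
    mul_nonneg (by norm_num) (intervalIntegral.integral_nonneg hu.1.le fun v _ => hnn u v hu.2),
    two_inv_mul_ofReal, intervalIntegral.integral_const_mul]
  simp only [div_pow, intervalIntegral.integral_div]
  rw [integral_integral_pow h0 h1]
  congr 1
  rw [show l.val + 1 = N + 2 by have : i.val < l.val := hil; omega, pow_add]
  simp only [one_pow]
  ring

end Events

/-! ### The arrival times of the cards -/

instance (n : ℕ) : DiscreteMeasurableSpace (Equiv.Perm (Fin n)) := ⟨fun _ => trivial⟩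

/-- The law of the side of a card that lands facing up. -/
abbrev coinLaw : Measure Bool := (PMF.uniformOfFintype Bool).toMeasure

/-- The law of the drawn numbers. -/
abbrev drawLaw : Measure ℝ := (volume : Measure ℝ).restrict (Set.Icc 0 1)

/-- The law of the order in which the cards are flipped. -/
abbrev orderLaw (n : ℕ) : Measure (Equiv.Perm (Fin n)) :=
  (PMF.uniformOfFintype (Equiv.Perm (Fin n))).toMeasure

instance : IsProbabilityMeasure drawLaw where
  measure_univ := by simp

lemma measurable_sort (n : ℕ) : Measurable fun y : Fin n → ℝ => Tuple.sort y := by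
  refine measurable_to_countable' fun σ => ?_
  have : (fun y : Fin n → ℝ => Tuple.sort y) ⁻¹' {σ} = {y | (∀ i j, i ≤ j → y (σ i) ≤ y (σ j)) ∧
      ∀ i j, i < j → y (σ i) = y (σ j) → σ i < σ j} := by
    ext y
    rw [Set.mem_preimage, Set.mem_singleton_iff, eq_comm, Tuple.eq_sort_iff]
    rfl
  rw [this, Set.ofPred_and]
  simp only [Set.ofPred_forall]
  refine MeasurableSet.inter ?_ ?_
  · exact .iInter fun i => .iInter fun j => .iInter fun _ =>
      measurableSet_le (by fun_prop) (by fun_prop)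
  · refine .iInter fun i => .iInter fun j => .iInter fun _ => ?_
    by_cases h : σ i < σ j
    · simp [h]
    · simp only [h, imp_false]
      exact (measurableSet_eq_fun (by fun_prop) (by fun_prop)).compl

lemma measurePreserving_orderLaw_of_bijective {n : ℕ} (e : Equiv.Perm (Equiv.Perm (Fin n))) :
    MeasurePreserving e (orderLaw n) (orderLaw n) := by
  refine ⟨measurable_of_finite _, Measure.ext fun s _ => ?_⟩
  classical
  rw [Measure.map_apply (measurable_of_finite _) (.of_discrete),
    PMF.toMeasure_uniformOfFintype_apply _ (.of_discrete),
    PMF.toMeasure_uniformOfFintype_apply _ (.of_discrete)]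
  congr 2
  exact Fintype.card_congr (e.subtypeEquiv fun _ => Iff.rfl)

lemma measurePreserving_comp_perm {n : ℕ} (σ : Equiv.Perm (Fin n)) :
    MeasurePreserving (fun y : Fin n → ℝ => y ∘ σ) (Measure.pi fun _ => drawLaw)
      (Measure.pi fun _ => drawLaw) := by
  have := measurePreserving_piCongrLeft (α := fun _ : Fin n => ℝ) (fun _ => drawLaw) σ.symm
  convert! this using 1
  ext y i
  obtain ⟨j, rfl⟩ := σ.symm.surjective i
  simp [MeasurableEquiv.piCongrLeft, Equiv.piCongrLeft_apply_apply]

lemma measurable_perm_comp (n : ℕ) :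
    Measurable fun p : Equiv.Perm (Fin n) × (Fin n → ℝ) => p.2 ∘ p.1 :=
  measurable_from_prod_countable_right fun σ => (measurePreserving_comp_perm σ).measurable

/-- The arrival time of the hidden value of a card. -/
def cardTime {n : ℕ} (w : Outcome n) (c : Fin n) : ℝ := tau w (w.2.1.symm c)

/-- For fixed draws y, left translation and inversion make `Tuple.sort y * σ⁻¹` uniform, hence a
uniform permutation independent of y; permuting iid draws by it leaves them iid. -/
lemma measurePreserving_sorted_comp (n : ℕ) :
    MeasurePreserving
      (fun p : Equiv.Perm (Fin n) × (Fin n → ℝ) => p.2 ∘ (Tuple.sort p.2 * p.1.symm))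
      ((orderLaw n).prod (Measure.pi fun _ => drawLaw)) (Measure.pi fun _ => drawLaw) := by
  have h1 : MeasurePreserving
      (fun p : (Fin n → ℝ) × Equiv.Perm (Fin n) => (id p.1, Tuple.sort p.1 * p.2⁻¹))
      ((Measure.pi fun _ => drawLaw).prod (orderLaw n))
      ((Measure.pi fun _ => drawLaw).prod (orderLaw n)) := by
    refine (MeasurePreserving.id _).skew_product (g := fun y σ => Tuple.sort y * σ⁻¹) ?_
      (ae_of_all _ fun y => ?_)
    · refine measurable_from_prod_countable_left fun σ => ?_
      exact (measurable_of_finite fun ρ : Equiv.Perm (Fin n) => ρ * σ⁻¹).comp (measurable_sort n)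
    · exact (measurePreserving_orderLaw_of_bijective
        ((Equiv.inv _).trans (Equiv.mulLeft (Tuple.sort y)))).map_eq
  have h2 : MeasurePreserving (fun p : Equiv.Perm (Fin n) × (Fin n → ℝ) => (id p.1, p.2 ∘ p.1))
      ((orderLaw n).prod (Measure.pi fun _ => drawLaw))
      ((orderLaw n).prod (Measure.pi fun _ => drawLaw)) :=
    (MeasurePreserving.id _).skew_product (g := fun (σ : Equiv.Perm (Fin n)) (y : Fin n → ℝ) => y ∘ σ)
      (measurable_perm_comp n)
      (ae_of_all _ fun σ => (measurePreserving_comp_perm σ).map_eq)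
  exact measurePreserving_snd.comp (h2.comp (Measure.measurePreserving_swap.comp
    (h1.comp Measure.measurePreserving_swap)))

lemma measurePreserving_coins_cardTime (n : ℕ) :
    MeasurePreserving (fun w : Outcome n => (w.1, cardTime w)) (law n)
      ((Measure.pi fun _ => coinLaw).prod (Measure.pi fun _ => drawLaw)) :=
  (MeasurePreserving.id _).prod (measurePreserving_sorted_comp n)

instance (n : ℕ) : IsProbabilityMeasure (law n) := by unfold law; infer_instance

lemma coinLaw_singleton (b : Bool) : coinLaw {b} = 2⁻¹ := by
  rw [PMF.toMeasure_apply_singleton _ _ (MeasurableSet.singleton b)]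
  simp

lemma drawLaw_eq : drawLaw = (volume : Measure ℝ).restrict (Set.Ico 0 1) :=
  restrict_Ico_eq_restrict_Icc.symm

lemma measurable_ite_sub_one (s : Bool) :
    Measurable fun p : Bool × ℝ => if p.1 = s then p.2 - 1 else p.2 :=
  measurable_from_prod_countable_right fun b => by
    by_cases h : b = s
    · simp only [h, if_true]; fun_prop
    · simp only [h, if_false]; fun_prop

/-- The shifted and unshifted halves tile [-1, 1]. The draw law is taken on [0, 1) so that the two
pieces are disjoint. -/
lemma map_arrival (s : Bool) :
    (coinLaw.prod drawLaw).map (fun p => if p.1 = s then p.2 - 1 else p.2) = arrivalLaw := by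
  have hm := measurable_ite_sub_one s
  refine Measure.ext fun E hE => ?_
  have hshift : drawLaw ((fun x : ℝ => x - 1) ⁻¹' E) = volume (E ∩ Set.Ico (-1) 0) := by
    rw [drawLaw_eq, Measure.restrict_apply (hE.preimage (by fun_prop)),
      ← measurePreserving_sub_right volume (1 : ℝ) |>.measure_preimage
        (hE.inter measurableSet_Ico).nullMeasurableSet]
    congr 1
    ext x
    simp
  have hid : drawLaw E = volume (E ∩ Set.Icc 0 1) := Measure.restrict_apply hE
  have hsum : volume (E ∩ Set.Icc (-1 : ℝ) 1) =
      volume (E ∩ Set.Ico (-1 : ℝ) 0) + volume (E ∩ Set.Icc (0 : ℝ) 1) := by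
    rw [← measure_union _ (hE.inter measurableSet_Icc), ← Set.inter_union_distrib_left,
      Set.Ico_union_Icc_eq_Icc (by norm_num) (by norm_num)]
    refine Set.disjoint_left.2 fun x h1 h2 => ?_
    exact absurd h1.2.2 (not_lt.2 h2.2.1)
  rw [Measure.map_apply hm hE, Measure.prod_apply (hm hE), lintegral_fintype]
  simp only [coinLaw_singleton, Set.preimage_preimage]
  rw [arrivalLaw, Measure.smul_apply, Measure.restrict_apply hE, hsum, ← hshift, ← hid, smul_eq_mul]
  cases s <;> simp [mul_add, mul_comm, add_comm]

/-- The arrival time of the value on side `S c` of card `c`. -/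
def position {n : ℕ} (S : Fin n → Bool) (c : Fin n) (w : Outcome n) : ℝ :=
  if w.1 c = S c then cardTime w c - 1 else cardTime w c

lemma measurePreserving_position {n : ℕ} (S : Fin n → Bool) :
    MeasurePreserving (fun w c => position S c w) (law n) (Measure.pi fun _ => arrivalLaw) := by
  have h1 := (measurePreserving_arrowProdEquivProdArrow Bool ℝ (Fin n) (fun _ => coinLaw)
    (fun _ => drawLaw)).symm
  have h2 := measurePreserving_pi (fun _ : Fin n => coinLaw.prod drawLaw) (fun _ => arrivalLaw)
    (f := fun c p => if p.1 = S c then p.2 - 1 else p.2)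
    fun c => ⟨measurable_ite_sub_one _, map_arrival (S c)⟩
  exact h2.comp (h1.comp (measurePreserving_coins_cardTime n))

lemma measurable_position {n : ℕ} (S : Fin n → Bool) (c : Fin n) : Measurable (position S c) :=
  (measurable_pi_apply c).comp (measurePreserving_position S).measurable

lemma map_position {n : ℕ} (S : Fin n → Bool) (c : Fin n) :
    (law n).map (position S c) = arrivalLaw :=
  ((measurePreserving_eval _ c).comp (measurePreserving_position S)).map_eq

lemma iIndepFun_position {n : ℕ} (S : Fin n → Bool) : iIndepFun (position S) (law n) := by
  rw [iIndepFun_iff_map_fun_eq_pi_map fun c => (measurable_position S c).aemeasurable,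
    (measurePreserving_position S).map_eq]
  simp only [map_position]

lemma ae_cardTime_mem (n : ℕ) : ∀ᵐ w ∂law n, ∀ c, 0 ≤ cardTime w c ∧ cardTime w c < 1 := by
  rw [ae_all_iff]
  intro c
  have h : MeasurePreserving (fun w => cardTime w c) (law n) drawLaw :=
    (measurePreserving_eval _ c).comp
      (measurePreserving_snd.comp (measurePreserving_coins_cardTime n))
  refine h.quasiMeasurePreserving.ae (p := fun x => 0 ≤ x ∧ x < 1) ?_
  rw [drawLaw_eq]
  exact (ae_restrict_iff' measurableSet_Ico).2 (ae_of_all _ fun x hx => hx)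

lemma ae_pi_drawLaw_ne {n : ℕ} {c d : Fin n} (hcd : c ≠ d) :
    ∀ᵐ x ∂(Measure.pi fun _ : Fin n => drawLaw), x c ≠ x d := by
  have hI : iIndepFun (fun (c : Fin n) (x : Fin n → ℝ) => x c) (Measure.pi fun _ => drawLaw) :=
    iIndepFun_pi (X := fun _ x => x) fun _ => aemeasurable_id
  have hmap := (indepFun_iff_map_prod_eq_prod_map_map
    (measurable_pi_apply c).aemeasurable (measurable_pi_apply d).aemeasurable).1 (hI.indepFun hcd)
  rw [(measurePreserving_eval (fun _ : Fin n => drawLaw) c).map_eq,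
    (measurePreserving_eval (fun _ : Fin n => drawLaw) d).map_eq] at hmap
  have hD : MeasurableSet {p : ℝ × ℝ | p.1 = p.2} :=
    measurableSet_eq_fun measurable_fst measurable_snd
  have h0 : (drawLaw.prod drawLaw) {p : ℝ × ℝ | p.1 = p.2} = 0 := by
    rw [Measure.prod_apply hD]
    refine lintegral_eq_zero_of_ae_eq_zero (ae_of_all _ fun x => ?_)
    have : Prod.mk x ⁻¹' {p : ℝ × ℝ | p.1 = p.2} = {x} := by
      ext y
      simp [eq_comm]
    simp only [this, Pi.zero_apply]
    exact measure_singleton x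
  rw [← hmap, Measure.map_apply (by fun_prop) hD] at h0
  rw [ae_iff]
  simpa using h0

lemma ae_cardTime_injective (n : ℕ) : ∀ᵐ w ∂law n, Function.Injective (cardTime w) := by
  have h : ∀ᵐ w ∂law n, ∀ c d, c ≠ d → cardTime w c ≠ cardTime w d := by
    simp only [ae_all_iff]
    intro c d hcd
    exact (measurePreserving_snd.comp
      (measurePreserving_coins_cardTime n)).quasiMeasurePreserving.ae (ae_pi_drawLaw_ne hcd)
  filter_upwards [h] with w hw c d hcd
  by_contra hne
  exact hw c d hne hcd

variable {n : ℕ}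

/-! ### The value that is selected -/

/-- The sides `(top a, S (top a))`, for `a < m`, carry the `m` largest values, in decreasing
order. -/
structure Instance.IsTop (I : Instance n) {m : ℕ} (top : Fin m → Fin n) (S : Fin n → Bool) :
    Prop where
  strictAnti : StrictAnti fun a => I.val (top a) (S (top a))
  eq_or_lt : ∀ c s, (∃ a, c = top a ∧ s = S c) ∨ ∀ a, I.val c s < I.val (top a) (S (top a))

lemma Instance.IsTop.injective {I : Instance n} {m : ℕ} {top : Fin m → Fin n} {S : Fin n → Bool}
    (h : I.IsTop top S) : Function.Injective top := fun a b hab =>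
  h.strictAnti.injective (by simp only [hab])

lemma Instance.IsTop.exists_of_le {I : Instance n} {m : ℕ} {top : Fin m → Fin n} {S : Fin n → Bool}
    (h : I.IsTop top S) {c : Fin n} {s : Bool} {a : Fin m}
    (hle : I.val (top a) (S (top a)) ≤ I.val c s) : ∃ b ≤ a, c = top b ∧ s = S c := by
  rcases h.eq_or_lt c s with ⟨b, rfl, rfl⟩ | hlt
  · exact ⟨b, h.strictAnti.le_iff_ge.1 hle, rfl, rfl⟩
  · exact absurd (hlt a) (not_lt.2 hle)

lemma tau_eq_cardTime (w : Outcome n) (s : Fin n) : tau w s = cardTime w (w.2.1 s) := by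
  simp [cardTime]

lemma tau_mono (w : Outcome n) : Monotone (tau w) := Tuple.monotone_sort w.2.2

lemma position_nonneg_iff {S : Fin n → Bool} {c : Fin n} {w : Outcome n}
    (hx : 0 ≤ cardTime w c ∧ cardTime w c < 1) : 0 ≤ position S c w ↔ w.1 c ≠ S c := by
  unfold position
  split_ifs with h
  · simp only [h, ne_eq, not_true, iff_false, not_le]
    linarith [hx.2]
  · simp [h, hx.1]

lemma Instance.alg_nonneg (I : Instance n) (t : ℝ) (w : Outcome n) : 0 ≤ I.alg t w :=
  Finset.sum_nonneg fun s _ => by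
    split_ifs
    exacts [I.nonneg _ _, le_rfl]

lemma Instance.alg_eq_of_stopsAt (I : Instance n) {t : ℝ} {w : Outcome n} {s : Fin n}
    (h : I.StopsAt t w s) : I.alg t w = I.down w (w.2.1 s) := by
  unfold Instance.alg
  rw [Finset.sum_eq_single s, if_pos h]
  · intro r _ hr
    rw [if_neg]
    intro h'
    rcases lt_or_gt_of_ne hr with hlt | hlt
    · exact h.2 r hlt h'.1
    · exact h'.2 s hlt h.1
  · exact fun h => absurd (Finset.mem_univ s) h

lemma Instance.down_eq {I : Instance n} {w : Outcome n} {c : Fin n} {s : Bool} (h : w.1 c ≠ s) :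
    I.down w c = I.val c s := by
  unfold Instance.down
  rw [(Bool.eq_not_of_ne h.symm).symm]

section Selection

variable {I : Instance n} {m : ℕ} {top : Fin m → Fin n} {S : Fin n → Bool} {t : ℝ}
  {w : Outcome n}

/-- The `i`-th largest value is selected if it is acceptable, and neither preempted nor isolated. -/
lemma Instance.IsTop.alg_eq (h : I.IsTop top S) (ht0 : 0 ≤ t)
    (hx : ∀ c, 0 ≤ cardTime w c ∧ cardTime w c < 1) (hinj : Function.Injective (cardTime w))
    {i : Fin m} (ha : Acceptable t (fun r => position S (top r) w) i)
    (hp : ∀ l, i < l → ¬ Preempts t (fun r => position S (top r) w) i l)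
    (hs : ¬ Isolated t (fun r => position S (top r) w) i) :
    I.alg t w = I.val (top i) (S (top i)) := by
  have hpos (c : Fin n) (hc : w.1 c ≠ S c) : position S c w = cardTime w c := if_neg hc
  have hneg (c : Fin n) (hc : w.1 c = S c) : position S c w = cardTime w c - 1 := if_pos hc
  have hci : w.1 (top i) ≠ S (top i) := (position_nonneg_iff (hx _)).1 ha.1
  have hD : I.down w (top i) = I.val (top i) (S (top i)) := I.down_eq hci
  have hzi := hpos _ hci
  obtain ⟨s, hsi⟩ := w.2.1.surjective (top i)
  have hstops : I.StopsAt t w s := by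
    constructor
    · intro r
      rw [tau_eq_cardTime, tau_eq_cardTime, hsi, hD]
      constructor
      · intro hmem
        by_contra hle
        obtain ⟨b, hb, hc, hside⟩ := h.exists_of_le (not_lt.1 hle)
        have hbi : b ≠ i := by
          rintro rfl
          rw [hc] at hside
          exact hci hside
        refine ha.2 b (lt_of_le_of_ne hb hbi) ?_
        simp only [hzi]
        rw [← hc, hneg _ hside]
        exact hmem
      · intro hmem
        by_contra hle
        obtain ⟨b, hb, hc, hside⟩ := h.exists_of_le (not_lt.1 hle)
        have hbi : b ≠ i := by
          rintro rfl
          rw [hc] at hmem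
          exact lt_irrefl _ hmem.2
        refine ha.2 b (lt_of_le_of_ne hb hbi) ?_
        simp only [hzi]
        rw [← hc, hpos _ fun h' => by simp [h'] at hside]
        exact hmem
    -- An accepted earlier step r must lead to preemption or isolation.
    · intro r hrs hacc
      have hrlt : cardTime w (w.2.1 r) < cardTime w (top i) := by
        refine lt_of_le_of_ne ?_ fun heq => ?_
        · rw [← hsi, ← tau_eq_cardTime, ← tau_eq_cardTime]
          exact tau_mono w hrs.le
        · have := hinj heq
          rw [← hsi] at this
          exact hrs.ne (w.2.1.injective this)
      obtain ⟨d, hd, hdmax⟩ := Finset.exists_max_image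
        (Finset.univ.filter fun c => cardTime w c < cardTime w (top i)) (I.down w)
        ⟨w.2.1 r, by simpa using hrlt⟩
      simp only [Finset.mem_filter, Finset.mem_univ, true_and] at hd hdmax
      -- If d came before step r it would lie in the window of r, since every earlier hidden value
      -- does, and would have to be smaller than the value accepted there.
      have hed : cardTime w (w.2.1 r) ≤ cardTime w d := by
        by_contra hlt
        obtain ⟨q, hq⟩ := w.2.1.surjective d
        have := (hacc q).2
        rw [tau_eq_cardTime, tau_eq_cardTime, hq] at this
        refine absurd (this ⟨max_le ?_ ?_, not_le.1 hlt⟩) (not_lt.2 (hdmax _ hrlt))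
        · linarith [(hx d).1, (hx (w.2.1 r)).2]
        · linarith [(hx d).1]
      -- Values above d cannot arrive in this interval: a visible one would lie in the window of r
      -- and block its acceptance, a hidden one would contradict the maximality of d.
      have key (f : Fin n) (hf : I.down w d < I.val f (S f)) (lo : ℝ)
          (hlo : cardTime w (w.2.1 r) - 1 - t ≤ lo) :
          position S f w ∉ Set.Ico (max lo (-1)) (cardTime w (top i)) := by
        intro hmem
        by_cases hside : w.1 f = S f
        · rw [hneg f hside] at hmem
          obtain ⟨q, hq⟩ := w.2.1.surjective f
          have := (hacc q).1
          rw [tau_eq_cardTime, tau_eq_cardTime, hq] at this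
          have hup := this ⟨(max_le_max_right _ hlo).trans hmem.1,
            by linarith [(hx f).2, (hx (w.2.1 r)).1]⟩
          rw [Instance.up, hside] at hup
          exact absurd (hup.trans_le (hdmax _ hrlt)) hf.not_gt
        · rw [hpos f hside] at hmem
          have := hdmax f hmem.2
          rw [I.down_eq hside] at this
          exact absurd this (not_le.2 hf)
      rcases h.eq_or_lt d (!(w.1 d)) with ⟨l, hl, hside⟩ | hlt
      · have hdS : w.1 d ≠ S d := fun h' => by simp [h'] at hside
        have hDd : I.down w d = I.val (top l) (S (top l)) := by rw [I.down_eq hdS, hl]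
        have hzl : position S (top l) w = cardTime w d := by rw [← hl, hpos d hdS]
        have hil : i < l := by
          by_contra hle
          rcases (not_lt.1 hle).eq_or_lt with rfl | hli
          · rw [hl] at hd
            exact lt_irrefl _ hd
          · refine ha.2 l hli ?_
            simp only [hzi, hzl]
            refine ⟨max_le ?_ ?_, hd⟩
            · linarith [(hx d).1, (hx (top i)).2]
            · linarith [(hx d).1]
        refine hp l hil ⟨⟨?_, ?_⟩, fun b hb _ => ?_⟩
        · simp only [hzl]
          exact (hx d).1
        · simp only [hzl, hzi]
          exact hd.le
        · simp only [hzl, hzi]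
          refine key (top b) ?_ _ (by linarith)
          rw [hDd]
          exact h.strictAnti hb
      -- Here d is below all top values, so `key` applies to each of them.
      · refine hs ⟨ha.1, fun b _ => ?_⟩
        simp only [hzi]
        exact key (top b) (hlt b) _ (by linarith)
  rw [I.alg_eq_of_stopsAt hstops, hsi, hD]

end Selection

/-! ### Measurability -/

lemma measurable_tau (s : Fin n) : Measurable fun w : Outcome n => tau w s := by
  have h : Measurable fun p : Equiv.Perm (Fin n) × (Fin n → ℝ) => p.2 (p.1 s) :=
    (measurable_pi_apply s).comp (measurable_perm_comp n)
  exact h.comp (((measurable_sort n).comp (measurable_snd.comp measurable_snd)).prodMk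
    (measurable_snd.comp measurable_snd))

lemma measurable_of_coins_order (f : (Fin n → Bool) → Equiv.Perm (Fin n) → ℝ) :
    Measurable fun w : Outcome n => f w.1 w.2.1 :=
  (measurable_of_countable fun p : (Fin n → Bool) × Equiv.Perm (Fin n) => f p.1 p.2).comp
    (measurable_fst.prodMk (measurable_fst.comp measurable_snd))

lemma Instance.measurableSet_accepts (I : Instance n) (t : ℝ) (s : Fin n) :
    MeasurableSet {w | I.Accepts t w s} := by
  have hd (r : Fin n) : Measurable fun w : Outcome n => I.down w (w.2.1 r) :=
    measurable_of_coins_order fun c σ => I.val (σ r) (!(c (σ r)))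
  have hu (r : Fin n) : Measurable fun w : Outcome n => I.up w (w.2.1 r) :=
    measurable_of_coins_order fun c σ => I.val (σ r) (c (σ r))
  have hmem {f : Outcome n → ℝ} (hf : Measurable f) :
      MeasurableSet {w | f w ∈ window t (tau w s)} := by
    simp only [window, Set.mem_Ico, Set.ofPred_and]
    exact (measurableSet_le ((((measurable_tau s).sub_const 1).sub_const t).max
      measurable_const) hf).inter (measurableSet_lt hf (measurable_tau s))
  have himp {p q : Outcome n → Prop} (hp : MeasurableSet {w | p w}) (hq : MeasurableSet {w | q w}) :
      MeasurableSet {w | p w → q w} := by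
    simp only [imp_iff_not_or, Set.ofPred_or]
    exact hp.compl.union hq
  simp only [Instance.Accepts, Set.ofPred_forall, Set.ofPred_and]
  exact .iInter fun r => (himp (hmem ((measurable_tau r).sub_const 1))
    (measurableSet_lt (hu r) (hd s))).inter
    (himp (hmem (measurable_tau r)) (measurableSet_lt (hd r) (hd s)))

lemma Instance.measurable_alg (I : Instance n) (t : ℝ) : Measurable (I.alg t) := by
  refine Finset.measurable_fun_sum _ fun s _ => Measurable.ite ?_
    (measurable_of_coins_order fun c σ => I.val (σ s) (!(c (σ s)))) measurable_const
  simp only [Instance.StopsAt, Set.ofPred_forall, Set.ofPred_and]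
  exact (I.measurableSet_accepts t s).inter
    (.iInter fun r => .iInter fun _ => (I.measurableSet_accepts t r).compl)

lemma Instance.measurable_maxDown (I : Instance n) : Measurable I.maxDown :=
  measurable_of_coins_order fun c _ => ⨆ i, I.val i (!(c i))

lemma Instance.down_le_maxDown (I : Instance n) (w : Outcome n) (c : Fin n) :
    I.down w c ≤ I.maxDown w :=
  le_ciSup (f := fun i => I.down w i) (Set.finite_range _).bddAbove c

lemma Instance.maxDown_nonneg (I : Instance n) (w : Outcome n) : 0 ≤ I.maxDown w :=
  Real.iSup_nonneg fun _ => I.nonneg _ _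

lemma Instance.exists_maxDown_eq (I : Instance n) (hn : 0 < n) (w : Outcome n) :
    ∃ c, I.maxDown w = I.down w c := by
  have : Nonempty (Fin n) := ⟨⟨0, hn⟩⟩
  obtain ⟨c, hc⟩ := exists_eq_ciSup_of_finite (f := fun i => I.down w i)
  exact ⟨c, hc.symm⟩

/-! ### The index `k` -/

lemma Instance.rank_lt_rank (I : Instance n) {p q : Fin n × Bool}
    (h : I.val p.1 p.2 < I.val q.1 q.2) : I.rank q.1 q.2 < I.rank p.1 p.2 := by
  classical
  simp only [Instance.rank, Nat.card_eq_fintype_card, Fintype.card_subtype]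
  refine Finset.card_lt_card ⟨fun r hr => ?_, fun hsub => ?_⟩
  · simp only [Finset.mem_filter, Finset.mem_univ, true_and] at hr ⊢
    exact h.le.trans hr
  · have : p ∈ Finset.univ.filter fun r : Fin n × Bool => I.val q.1 q.2 ≤ I.val r.1 r.2 :=
      hsub (by simp)
    simp only [Finset.mem_filter, Finset.mem_univ, true_and] at this
    exact absurd h (not_lt.2 this)

lemma Instance.rank_pos (I : Instance n) (p : Fin n × Bool) : 0 < I.rank p.1 p.2 := by
  have : Nonempty {q : Fin n × Bool // I.val p.1 p.2 ≤ I.val q.1 q.2} := ⟨⟨p, le_rfl⟩⟩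
  exact Nat.card_pos

lemma Instance.rank_le (I : Instance n) (p : Fin n × Bool) : I.rank p.1 p.2 ≤ 2 * n := by
  refine (Nat.card_le_card_of_injective _ Subtype.val_injective).trans ?_
  simp [mul_comm]

lemma Instance.rank_injective (I : Instance n) :
    Function.Injective fun p : Fin n × Bool => I.rank p.1 p.2 := by
  intro p q hpq
  simp only at hpq
  rcases lt_trichotomy (I.val p.1 p.2) (I.val q.1 q.2) with h | h | h
  · exact absurd hpq (I.rank_lt_rank h).ne'
  · exact Prod.ext (I.inj _ _ _ _ h).1 (I.inj _ _ _ _ h).2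
  · exact absurd hpq (I.rank_lt_rank h).ne

lemma Instance.exists_rank_eq (I : Instance n) {r : ℕ} (h0 : 0 < r) (h1 : r ≤ 2 * n) :
    ∃ p : Fin n × Bool, I.rank p.1 p.2 = r := by
  have himg : Finset.univ.image (fun p : Fin n × Bool => I.rank p.1 p.2) = Finset.Icc 1 (2 * n) := by
    refine Finset.eq_of_subset_of_card_le (fun r hr => ?_) ?_
    · obtain ⟨p, _, rfl⟩ := Finset.mem_image.1 hr
      exact Finset.mem_Icc.2 ⟨I.rank_pos p, I.rank_le p⟩
    · rw [Finset.card_image_of_injective _ I.rank_injective]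
      simp [mul_comm]
  obtain ⟨p, _, hp⟩ := Finset.mem_image.1 (himg ▸ Finset.mem_Icc.2 ⟨h0, h1⟩)
  exact ⟨p, hp⟩

/-- By minimality of k, a value of rank below k is the larger one on its card; hence the first k - 1
values are on different cards, and S can be the larger side of every card. -/
lemma Instance.exists_isTop (I : Instance n) (hn : 0 < n) :
    ∃ m, 0 < m ∧ I.k = m + 1 ∧ ∃ (top : Fin m → Fin n) (S : Fin n → Bool), I.IsTop top S := by
  set K : Set ℕ := {j : ℕ | ∃ i s, I.rank i s = j ∧ I.rank i (!s) < j} with hK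
  have hne : K.Nonempty := by
    have hd : I.rank ⟨0, hn⟩ true ≠ I.rank ⟨0, hn⟩ false := fun h => by
      simpa using I.rank_injective (a₁ := (⟨0, hn⟩, true)) (a₂ := (⟨0, hn⟩, false)) h
    rcases lt_or_gt_of_ne hd with h | h
    · exact ⟨_, ⟨0, hn⟩, false, rfl, h⟩
    · exact ⟨_, ⟨0, hn⟩, true, rfl, h⟩
  obtain ⟨c, s, hcs, hlt⟩ : I.k ∈ K := Nat.sInf_mem hne
  have hkmin {i s} (h : I.rank i (!s) < I.rank i s) : I.k ≤ I.rank i s :=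
    Nat.sInf_le ⟨i, s, rfl, h⟩
  have hk2 : 2 ≤ I.k := by
    have := I.rank_pos (c, !s)
    simp only at this
    omega
  have hkn : I.k ≤ 2 * n := hcs ▸ I.rank_le (c, s)
  refine ⟨I.k - 1, by omega, by omega, ?_⟩
  choose p hp using fun a : Fin (I.k - 1) => I.exists_rank_eq (r := a + 1) (by omega)
    (by have := a.2; omega)
  set S : Fin n → Bool := fun c => decide (I.val c false < I.val c true) with hS
  have hside {q : Fin n × Bool} (hq : I.rank q.1 q.2 < I.k) : S q.1 = q.2 := by
    have hle : I.val q.1 (!q.2) < I.val q.1 q.2 := by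
      by_contra hle
      have hne : I.val q.1 q.2 ≠ I.val q.1 (!q.2) := fun h => by
        simpa using (I.inj _ _ _ _ h).2
      have := I.rank_lt_rank (p := q) (q := (q.1, !q.2)) (lt_of_le_of_ne (not_lt.1 hle) hne)
      exact absurd (hkmin this) (not_le.2 hq)
    obtain ⟨c, s⟩ := q
    cases s
    · simpa [hS] using hle.le
    · simpa [hS] using hle
  have hpS (a : Fin (I.k - 1)) : S (p a).1 = (p a).2 :=
    hside (by rw [hp]; have := a.2; omega)
  refine ⟨fun a => (p a).1, S, fun a b hab => ?_, fun c s => ?_⟩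
  · simp only [hpS]
    by_contra hle
    rcases (not_lt.1 hle).eq_or_lt with h | h
    · have : p a = p b := Prod.ext (I.inj _ _ _ _ h).1 (I.inj _ _ _ _ h).2
      have h1 := hp a
      rw [this, hp b] at h1
      have : a.val < b.val := hab
      omega
    · have := I.rank_lt_rank h
      rw [hp, hp] at this
      have : a.val < b.val := hab
      omega
  · simp only [hpS]
    rcases lt_or_ge (I.rank c s) I.k with h | h
    · left
      have h0 := I.rank_pos (c, s)
      simp only at h0
      have : (c, s) = p ⟨I.rank c s - 1, by omega⟩ := I.rank_injective (by
        simp only [hp]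
        omega)
      exact ⟨_, congrArg Prod.fst this, (hside (q := (c, s)) h).symm⟩
    · right
      intro a
      by_contra hle
      have hne : I.val (p a).1 (p a).2 ≠ I.val c s := fun heq => by
        obtain ⟨h1, h2⟩ := I.inj _ _ _ _ heq
        have := hp a
        rw [h1, h2] at this
        have := a.2
        omega
      have := I.rank_lt_rank (p := p a) (q := (c, s)) (lt_of_le_of_ne (not_lt.1 hle) hne)
      rw [hp] at this
      simp only at this
      have := a.2
      omega

/-! ### The guarantee -/

lemma alpha_nonneg {t : ℝ} (h0 : 0 ≤ t) (h1 : t ≤ 1) (N : ℕ) : 0 ≤ alpha t N :=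
  add_nonneg (intervalIntegral.integral_nonneg h0 fun x hx =>
    pow_nonneg (by linarith [hx.2]) _) (pow_nonneg (by linarith) _)

lemma beta_nonneg {t : ℝ} (h0 : 0 ≤ t) (h1 : t ≤ 1) (N : ℕ) : 0 ≤ beta t N :=
  add_nonneg (intervalIntegral.integral_nonneg h0 fun x hx =>
    mul_nonneg hx.1 (pow_nonneg (by linarith [hx.2]) _))
    (intervalIntegral.integral_nonneg h1 fun x hx =>
      mul_nonneg (by linarith [hx.2]) (pow_nonneg (by linarith [hx.2]) _))

lemma sum_Ioi_beta (t : ℝ) {m : ℕ} (i : Fin m) :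
    ∑ l ∈ Finset.Ioi i, (1 / 2 : ℝ) ^ (l.val + 1) * beta t (l - 1) =
      (1 / 2) ^ (i.val + 1) *
        ∑ r ∈ Finset.range (m - (i + 1)), (1 / 2) ^ (r + 1) * beta t (i + r) := by
  have h1 : ∑ l ∈ Finset.Ioi i, (1 / 2 : ℝ) ^ (l.val + 1) * beta t (l - 1) =
      ∑ l ∈ (Finset.Ioi i).map Fin.valEmbedding, (1 / 2 : ℝ) ^ (l + 1) * beta t (l - 1) := by
    rw [Finset.sum_map]
    rfl
  have h2 : (Finset.Ioi i).map Fin.valEmbedding = Finset.Ico (i.val + 1) m := by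
    ext l
    simp only [Finset.mem_map, Finset.mem_Ioi, Fin.valEmbedding_apply, Finset.mem_Ico]
    constructor
    · rintro ⟨a, ha, rfl⟩
      exact ⟨ha, a.2⟩
    · rintro ⟨ha, hm⟩
      exact ⟨⟨l, hm⟩, ha, rfl⟩
  rw [h1, h2, Finset.sum_Ico_eq_sum_range, Finset.mul_sum]
  refine Finset.sum_congr rfl fun r _ => ?_
  rw [show i.val + 1 + r - 1 = i + r by omega]
  ring

/-- The `i`-th largest value is selected with almost the probability it has for `k → ∞`. -/
lemma Instance.IsTop.le_measure_alg_eq {I : Instance n} {m : ℕ} {top : Fin m → Fin n}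
    {S : Fin n → Bool} (h : I.IsTop top S) {t : ℝ} (h0 : 0 ≤ t) (h1 : t ≤ 1) (i : Fin m) :
    (1 / 2) ^ (i.val + 1) * selectWeight t i - (1 / 2) ^ m ≤
      (law n).real {w | I.alg t w = I.val (top i) (S (top i))} := by
  have hZ : iIndepFun (fun a : Fin m => position S (top a)) (law n) :=
    (iIndepFun_position S).precomp h.injective
  have hm (a : Fin m) : Measurable (position S (top a)) := measurable_position S _
  have hlaw (a : Fin m) : (law n).map (position S (top a)) = arrivalLaw := map_position S _
  set E := {w | I.alg t w = I.val (top i) (S (top i))}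
  set A := {w : Outcome n | Acceptable t (fun r => position S (top r) w) i}
  set P := fun l : Fin m => {w : Outcome n | Preempts t (fun r => position S (top r) w) i l}
  set Q := {w : Outcome n | Isolated t (fun r => position S (top r) w) i}
  have hA : (law n).real A = (1 / 2) ^ (i.val + 1) * alpha t i := by
    rw [measureReal_def, measure_acceptable h0 h1 hZ hm hlaw,
      ENNReal.toReal_ofReal (mul_nonneg (by positivity) (alpha_nonneg h0 h1 _))]
  have hQ : (law n).real Q ≤ (1 / 2) ^ m :=
    ENNReal.toReal_le_of_le_ofReal (by positivity) (measure_isolated_le h0 h1 hZ hm hlaw i)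
  have hP : (law n).real (⋃ l ∈ Finset.Ioi i, P l) ≤
      ∑ l ∈ Finset.Ioi i, (1 / 2 : ℝ) ^ (l.val + 1) * beta t (l - 1) := by
    refine (measureReal_biUnion_finset_le _ _).trans (Finset.sum_le_sum fun l hl => ?_)
    rw [measureReal_def, measure_preempts h0 h1 hZ hm hlaw (Finset.mem_Ioi.1 hl),
      ENNReal.toReal_ofReal (mul_nonneg (by positivity) (beta_nonneg h0 h1 _))]
  -- The inclusion holds only almost surely: coinciding times and the time 1 have to be excluded.
  have hsub : (law n).real A ≤ (law n).real (E ∪ (⋃ l ∈ Finset.Ioi i, P l) ∪ Q) := by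
    refine ENNReal.toReal_mono (measure_ne_top _ _) (measure_mono_ae ?_)
    filter_upwards [ae_cardTime_mem n, ae_cardTime_injective n] with w hx hinj hw
    by_contra hnot
    have hnot' : ¬ ((w ∈ E ∨ w ∈ ⋃ l ∈ Finset.Ioi i, P l) ∨ w ∈ Q) := hnot
    simp only [not_or, Set.mem_iUnion, not_exists, Finset.mem_Ioi] at hnot'
    exact hnot'.1.1 (h.alg_eq h0 hx hinj hw hnot'.1.2 hnot'.2)
  have hu1 := measureReal_union_le (μ := law n) (E ∪ ⋃ l ∈ Finset.Ioi i, P l) Q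
  have hu2 := measureReal_union_le (μ := law n) E (⋃ l ∈ Finset.Ioi i, P l)
  rw [sum_Ioi_beta] at hP
  have hb := mul_le_mul_of_nonneg_left (sum_beta_le h0 h1 i (m - (i + 1)))
    (show (0 : ℝ) ≤ (1 / 2) ^ (i.val + 1) by positivity)
  rw [mul_sub] at hb
  linarith

/-- The probability that the selected value is at least `u`, when `j` of the `m` largest values
are. -/
lemma Instance.IsTop.le_measure_le_alg {I : Instance n} {m : ℕ} {top : Fin m → Fin n}
    {S : Fin n → Bool} (h : I.IsTop top S) {t : ℝ} (h0 : 0.11 < t) (h1 : t < 0.115)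
    (hr : rootFun t = 0) {j : ℕ} (hj : j ≤ m) {u : ℝ}
    (hu : ∀ a : Fin m, a.val < j → u ≤ I.val (top a) (S (top a))) :
    Rinf t * (1 - (1 / 2) ^ j) - j * (1 / 2) ^ m ≤ (law n).real {w | u ≤ I.alg t w} := by
  have ht0 : 0 ≤ t := by norm_num at h0; linarith
  have ht1 : t ≤ 1 := by norm_num at h1; linarith
  set E : Fin j → Set (Outcome n) := fun a =>
    {w | I.alg t w = I.val (top (a.castLE hj)) (S (top (a.castLE hj)))}
  have hdisj : Pairwise (Function.onFun Disjoint E) := by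
    intro a b hab
    refine Set.disjoint_left.2 fun w ha hb => hab ?_
    have : a.castLE hj = b.castLE hj := h.strictAnti.injective (ha.out.symm.trans hb.out)
    exact Fin.castLE_injective hj this
  have hmeas (a : Fin j) : MeasurableSet (E a) := I.measurable_alg t (measurableSet_singleton _)
  calc Rinf t * (1 - (1 / 2) ^ j) - j * (1 / 2) ^ m
      ≤ ∑ i ∈ Finset.range j, ((1 / 2) ^ (i + 1) * selectWeight t i - (1 / 2) ^ m) := by
        rw [Finset.sum_sub_distrib]
        simp only [Finset.sum_const, Finset.card_range, nsmul_eq_mul]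
        linarith [le_sum_selectWeight h0 h1 hr j]
    _ = ∑ a : Fin j, ((1 / 2) ^ (a.val + 1) * selectWeight t a - (1 / 2) ^ m) :=
        Finset.sum_range _
    _ ≤ ∑ a : Fin j, (law n).real (E a) :=
        Finset.sum_le_sum fun a _ => h.le_measure_alg_eq ht0 ht1 (a.castLE hj)
    _ = (law n).real (⋃ a, E a) := (measureReal_iUnion_fintype hdisj hmeas).symm
    _ ≤ (law n).real {w | u ≤ I.alg t w} := by
        refine measureReal_mono (Set.iUnion_subset fun a w hw => ?_)
        exact (hu (a.castLE hj) a.2).trans_eq hw.out.symm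

lemma arrivalLaw_Iio_zero : arrivalLaw (Set.Iio 0) = ENNReal.ofReal (1 / 2) := by
  have : Set.Iio (0 : ℝ) ∩ Set.Icc (-1) 1 = Set.Ico (-1) 0 ∩ Set.Icc (-1) 1 := by
    ext x
    simp only [Set.mem_inter_iff, Set.mem_Iio, Set.mem_Icc, Set.mem_Ico]
    tauto
  have h2 := arrivalLaw_Ico (a := -1) (b := 0) le_rfl zero_le_one
  rw [arrivalLaw, Measure.smul_apply, Measure.restrict_apply measurableSet_Ico] at h2
  rw [arrivalLaw, Measure.smul_apply, Measure.restrict_apply measurableSet_Iio, this, h2]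
  norm_num

/-- The probability that the largest hidden value is at least `u`, when this holds for just `j < m`
of all values. -/
lemma Instance.IsTop.measure_le_maxDown {I : Instance n} {m : ℕ} {top : Fin m → Fin n}
    {S : Fin n → Bool} (h : I.IsTop top S) {j : ℕ} (hj : j < m) {u : ℝ}
    (hu : ∀ a : Fin m, u ≤ I.val (top a) (S (top a)) → a.val < j) :
    (law n).real {w | u ≤ I.maxDown w} ≤ 1 - (1 / 2) ^ j := by
  have hn : 0 < n := (Nat.zero_le _).trans_lt (top ⟨j, hj⟩).2
  set Z : Fin j → Outcome n → ℝ := fun a => position S (top (a.castLE hj.le))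
  have hZ : iIndepFun Z (law n) :=
    (iIndepFun_position S).precomp (h.injective.comp (Fin.castLE_injective hj.le))
  set N : Set (Outcome n) := ⋂ a ∈ Finset.univ, Z a ⁻¹' Set.Iio 0
  have hNm : MeasurableSet N := Finset.measurableSet_biInter _ fun a _ =>
    measurable_position S _ measurableSet_Iio
  have hN : (law n).real N = (1 / 2) ^ j := by
    rw [measureReal_def, hZ.measure_inter_preimage_eq_mul (sets := fun _ => Set.Iio 0)
      Finset.univ fun _ _ => measurableSet_Iio]
    have (a : Fin j) : law n (Z a ⁻¹' Set.Iio 0) = ENNReal.ofReal (1 / 2) := by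
      rw [← Measure.map_apply (measurable_position S _) measurableSet_Iio, map_position,
        arrivalLaw_Iio_zero]
    simp only [this, Finset.prod_const, Finset.card_univ, Fintype.card_fin, ENNReal.toReal_pow]
    rw [ENNReal.toReal_ofReal (by norm_num)]
  rw [← hN, ← probReal_compl_eq_one_sub hNm]
  refine ENNReal.toReal_mono (measure_ne_top _ _) (measure_mono_ae ?_)
  filter_upwards [ae_cardTime_mem n] with w hx hw
  have hw' : u ≤ I.maxDown w := hw
  refine Set.mem_compl fun hwN => ?_
  obtain ⟨c, hc⟩ := I.exists_maxDown_eq hn w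
  rw [hc, Instance.down] at hw'
  rcases h.eq_or_lt c (!(w.1 c)) with ⟨a, rfl, hside⟩ | hlt
  · have ha := hu a (hside ▸ hw')
    have hpos : 0 ≤ position S (top a) w :=
      (position_nonneg_iff (hx _)).2 fun h' => by simp [h'] at hside
    have := Set.mem_iInter₂.1 hwN ⟨a, ha⟩ (Finset.mem_univ _)
    exact absurd hpos (not_le.2 this)
  -- A hidden value outside the top ones is below the top value of index j, which exists as j < m
  -- and is itself below u.
  · exact absurd (hu ⟨j, hj⟩ (hw'.trans (hlt _).le)) (lt_irrefl _)

lemma exists_count_of_strictAnti {m : ℕ} {Y : Fin m → ℝ} (hY : StrictAnti Y) (u : ℝ) :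
    ∃ j ≤ m, ∀ a : Fin m, u ≤ Y a ↔ a.val < j := by
  classical
  -- The count is the first index whose value is below u, or m if there is none.
  have hex : ∃ j, j = m ∨ ∃ h : j < m, Y ⟨j, h⟩ < u := ⟨m, Or.inl rfl⟩
  refine ⟨Nat.find hex, Nat.find_min' hex (Or.inl rfl), fun a => ⟨fun ha => ?_, fun ha => ?_⟩⟩
  · by_contra hle
    rcases Nat.find_spec hex with h | ⟨h, hlt⟩
    · have := a.2
      omega
    · have : Y a ≤ Y ⟨Nat.find hex, h⟩ := hY.antitone (not_lt.1 hle)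
      linarith
  · by_contra hlt
    exact Nat.find_min hex ha (Or.inr ⟨a.2, not_le.1 hlt⟩)

lemma rinf_lt_one {t : ℝ} (h0 : 0 ≤ t) (h1 : t ≤ 1) : Rinf t < 1 := by
  refine (rinf_antitoneOn ⟨le_rfl, zero_le_one⟩ ⟨h0, h1⟩ h0).trans_lt ?_
  rw [Rinf]
  norm_num
  linarith [Real.log_two_lt_d9]

/-- For each threshold `u`, the guarantee holds for the probabilities to obtain at least `u`. -/
lemma Instance.IsTop.mul_measure_le {I : Instance n} {m : ℕ} {top : Fin m → Fin n}
    {S : Fin n → Bool} (h : I.IsTop top S) {t : ℝ} (h0 : 0.11 < t) (h1 : t < 0.115)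
    (hr : rootFun t = 0) {ρ : ℝ} (hρ0 : 0 ≤ ρ)
    (hρ : ρ ≤ Rinf t - 8 * (m + 1) * (1 / 2) ^ m) (u : ℝ) :
    ρ * (law n).real {w | u ≤ I.maxDown w} ≤ (law n).real {w | u ≤ I.alg t w} := by
  have hR : Rinf t < 1 :=
    rinf_lt_one (by norm_num at h0; linarith) (by norm_num at h1; linarith)
  obtain ⟨j, hjm, hj⟩ := exists_count_of_strictAnti h.strictAnti u
  have hlow := h.le_measure_le_alg h0 h1 hr hjm fun a => (hj a).2
  have hx : (0 : ℝ) < (1 / 2) ^ m := by positivity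
  have hm0 : (0 : ℝ) ≤ m := Nat.cast_nonneg m
  rcases hjm.eq_or_lt with rfl | hlt
  -- When all m top values reach u, the trivial bound 1 for the maximum suffices: as `Rinf t` < 1,
  -- the loss is at most (m + 1) 2^(-m).
  · have h2 : ρ * (law n).real {w | u ≤ I.maxDown w} ≤ ρ :=
      mul_le_of_le_one_right hρ0 measureReal_le_one
    nlinarith
  · have h2 := mul_le_mul_of_nonneg_left (h.measure_le_maxDown hlt fun a => (hj a).1) hρ0
    refine h2.trans (le_trans ?_ hlow)
    rcases Nat.eq_zero_or_pos j with rfl | hpos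
    · simp
    -- The error j 2^(-m) is compared with 1 - 2^(-j) ≥ 1/2, so the ratio loses at most 2m 2^(-m);
    -- the constant 8 leaves room.
    · have hhalf : (1 / 2 : ℝ) ≤ 1 - (1 / 2) ^ j := by
        have : (1 / 2 : ℝ) ^ j ≤ (1 / 2) ^ 1 :=
          pow_le_pow_of_le_one (by norm_num) (by norm_num) hpos
        linarith
      have hjm' : (j : ℝ) ≤ m := by exact_mod_cast hjm
      have h3 : ρ * (1 - (1 / 2) ^ j) ≤
          (Rinf t - 8 * (m + 1) * (1 / 2) ^ m) * (1 - (1 / 2) ^ j) :=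
        mul_le_mul_of_nonneg_right hρ (by linarith)
      have h4 : 8 * (m + 1) * (1 / 2) ^ m * (1 / 2 : ℝ) ≤
          8 * (m + 1) * (1 / 2) ^ m * (1 - (1 / 2) ^ j) :=
        mul_le_mul_of_nonneg_left hhalf (by positivity)
      have h5 : (j : ℝ) * (1 / 2) ^ m ≤ m * (1 / 2) ^ m := mul_le_mul_of_nonneg_right hjm' hx.le
      nlinarith

/-! ### From thresholds to expectations -/

lemma Instance.maxDown_le (I : Instance n) (hn : 0 < n) (w : Outcome n) :
    I.maxDown w ≤ ∑ p : Fin n × Bool, I.val p.1 p.2 := by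
  obtain ⟨c, hc⟩ := I.exists_maxDown_eq hn w
  rw [hc]
  exact Finset.single_le_sum (f := fun p : Fin n × Bool => I.val p.1 p.2)
    (fun p _ => I.nonneg _ _) (Finset.mem_univ (c, !(w.1 c)))

lemma Instance.alg_le_maxDown (I : Instance n) (t : ℝ) (w : Outcome n) :
    I.alg t w ≤ I.maxDown w := by
  by_cases h : ∃ s, I.StopsAt t w s
  · obtain ⟨s, hs⟩ := h
    rw [I.alg_eq_of_stopsAt hs]
    exact I.down_le_maxDown w _
  · have : I.alg t w = 0 := Finset.sum_eq_zero fun s _ => if_neg fun hs => h ⟨s, hs⟩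
    rw [this]
    exact I.maxDown_nonneg w

lemma Instance.integrable_maxDown (I : Instance n) (hn : 0 < n) : Integrable I.maxDown (law n) :=
  .of_bound I.measurable_maxDown.aestronglyMeasurable _ (ae_of_all _ fun w => by
    rw [Real.norm_of_nonneg (I.maxDown_nonneg w)]
    exact I.maxDown_le hn w)

lemma Instance.integrable_alg (I : Instance n) (hn : 0 < n) (t : ℝ) :
    Integrable (I.alg t) (law n) :=
  (I.integrable_maxDown hn).mono (I.measurable_alg t).aestronglyMeasurable (ae_of_all _ fun w => by
    rw [Real.norm_of_nonneg (I.maxDown_nonneg w), Real.norm_of_nonneg (I.alg_nonneg t w)]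
    exact I.alg_le_maxDown t w)

/-- Layer-cake formula: both expectations are integrals over u > 0 of the tail probabilities. -/
lemma mul_integral_le_of_forall_mul_measure_le {Ω : Type*} [MeasurableSpace Ω] {μ : Measure Ω}
    [IsFiniteMeasure μ] {f g : Ω → ℝ} (hf : Integrable f μ) (hg : Integrable g μ) (hf0 : 0 ≤ f)
    (hg0 : 0 ≤ g) {ρ : ℝ} (hρ : 0 ≤ ρ)
    (h : ∀ u, ρ * μ.real {ω | u ≤ f ω} ≤ μ.real {ω | u ≤ g ω}) :
    ρ * ∫ ω, f ω ∂μ ≤ ∫ ω, g ω ∂μ := by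
  have hle : ENNReal.ofReal (ρ * ∫ ω, f ω ∂μ) ≤ ENNReal.ofReal (∫ ω, g ω ∂μ) := by
    rw [ENNReal.ofReal_mul hρ, ofReal_integral_eq_lintegral_ofReal hf (ae_of_all _ hf0),
      ofReal_integral_eq_lintegral_ofReal hg (ae_of_all _ hg0),
      lintegral_eq_lintegral_meas_le μ (ae_of_all _ hf0) hf.aemeasurable,
      lintegral_eq_lintegral_meas_le μ (ae_of_all _ hg0) hg.aemeasurable,
      ← lintegral_const_mul' _ _ ENNReal.ofReal_ne_top]
    refine lintegral_mono fun u => ?_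
    have := ENNReal.ofReal_le_ofReal (h u)
    rwa [ENNReal.ofReal_mul hρ, ofReal_measureReal, ofReal_measureReal] at this
  exact (ENNReal.ofReal_le_ofReal_iff (integral_nonneg hg0)).1 hle

/-- The largest value is positive, since the other side of its card carries a smaller non-negative
number, and it is hidden with probability 1/2. -/
lemma Instance.expMax_pos (I : Instance n) (hn : 0 < n) : 0 < I.expMax := by
  obtain ⟨m, hm, -, top, S, h⟩ := I.exists_isTop hn
  set c := top ⟨0, hm⟩
  have hval : 0 < I.val c (S c) := by
    by_contra hle
    have hz : I.val c (S c) = 0 := le_antisymm (not_lt.1 hle) (I.nonneg _ _)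
    obtain ⟨b, -, -, hside⟩ := h.exists_of_le (a := ⟨0, hm⟩) (c := c) (s := !(S c))
      (hz.trans_le (I.nonneg _ _))
    simp at hside
  have hprob : (law n).real (position S c ⁻¹' Set.Ici 0) = 1 / 2 := by
    have : position S c ⁻¹' Set.Ici 0 = (position S c ⁻¹' Set.Iio 0)ᶜ := by
      rw [← Set.preimage_compl, Set.compl_Iio]
    rw [this, probReal_compl_eq_one_sub (measurable_position S c measurableSet_Iio),
      measureReal_def, ← Measure.map_apply (measurable_position S c) measurableSet_Iio,
      map_position, arrivalLaw_Iio_zero, ENNReal.toReal_ofReal (by norm_num)]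
    norm_num
  have hle : ∫ w, Set.indicator (position S c ⁻¹' Set.Ici 0) (fun _ => I.val c (S c)) w ∂law n ≤
      I.expMax := by
    refine integral_mono_of_nonneg (ae_of_all _ fun w => Set.indicator_nonneg
      (fun _ _ => I.nonneg _ _) w) (I.integrable_maxDown hn) ?_
    filter_upwards [ae_cardTime_mem n] with w hx
    by_cases hw : 0 ≤ position S c w
    · rw [Set.indicator_of_mem (by exact hw), ← I.down_eq ((position_nonneg_iff (hx c)).1 hw)]
      exact I.down_le_maxDown w c
    · rw [Set.indicator_of_notMem (by exact hw)]
      exact I.maxDown_nonneg w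
  rw [integral_indicator (measurable_position S c measurableSet_Ici), setIntegral_const, hprob,
    smul_eq_mul] at hle
  linarith

lemma Instance.le_expAlg_div_expMax (I : Instance n) (hn : 0 < n) {t : ℝ} (h0 : 0.11 < t)
    (h1 : t < 0.115) (hr : rootFun t = 0) :
    Rinf t - 16 * (I.k : ℝ) / 2 ^ I.k ≤ I.expAlg t / I.expMax := by
  have hpos := I.expMax_pos hn
  obtain ⟨m, hm, hk, top, S, h⟩ := I.exists_isTop hn
  -- A negative bound is trivial, and the threshold argument needs a non-negative ratio.
  rcases lt_or_ge (Rinf t - 16 * (I.k : ℝ) / 2 ^ I.k) 0 with hneg | hρ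
  · exact hneg.le.trans (div_nonneg (integral_nonneg fun w => I.alg_nonneg t w) hpos.le)
  · rw [le_div_iff₀ hpos]
    refine mul_integral_le_of_forall_mul_measure_le (I.integrable_maxDown hn)
      (I.integrable_alg hn t) I.maxDown_nonneg (I.alg_nonneg t) hρ
      (h.mul_measure_le h0 h1 hr hρ (le_of_eq ?_))
    -- With k = m + 1, 16 k / 2^k is 8 (m + 1) / 2^m.
    rw [hk]
    push_cast
    rw [pow_succ, one_div_pow]
    field_simp
    ring

end Googol

end

theorem theorem3 :
    ∃ t : ℝ,
      -- `t` is the only root of the equation, with the stated numerical values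
      (0 < t ∧ t < 1 ∧ Googol.rootFun t = 0 ∧
        (∀ s : ℝ, -1 < s → Googol.rootFun s = 0 → s = t) ∧
        |t - 0.1128904| < 5 / 10 ^ 8 ∧
        0.6426317 < Googol.Rinf t ∧ Googol.Rinf t < 0.6426318) ∧
      -- the guarantee as `k` goes to infinity, uniformly over all instances
      (∀ ε : ℝ, 0 < ε → ∃ K : ℕ, ∀ n : ℕ, 0 < n → ∀ I : Googol.Instance n, K ≤ I.k →
        Googol.Rinf t - ε ≤ I.expAlg t / I.expMax) ∧
      -- the explicit guarantee for each finite `k`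
      (∀ n : ℕ, 0 < n → ∀ I : Googol.Instance n,
        0 < I.expMax ∧
        Googol.Rinf t - 16 * (I.k : ℝ) / 2 ^ I.k ≤ I.expAlg t / I.expMax) := by
  obtain ⟨t, ⟨hlo, hhi⟩, hroot, huniq, hR⟩ := Googol.exists_root
  have h0 : 0.11 < t := by norm_num at hlo ⊢; linarith
  have h1 : t < 0.115 := by norm_num at hhi ⊢; linarith
  refine ⟨t, ⟨by norm_num at h0; linarith, by norm_num at h1; linarith, hroot, huniq, ?_, hR⟩,
    fun ε hε => ?_, fun n hn I => ⟨I.expMax_pos hn, I.le_expAlg_div_expMax hn h0 h1 hroot⟩⟩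
  · rw [abs_lt]
    norm_num at hlo hhi ⊢
    constructor <;> linarith
  -- The uniform limit statement follows from the explicit bound, whose error depends on k alone.
  · have hlim : Filter.Tendsto (fun k : ℕ => 16 * ((k : ℝ) * (1 / 2) ^ k)) Filter.atTop
        (nhds (16 * 0)) :=
      (tendsto_self_mul_const_pow_of_lt_one (by norm_num) (by norm_num)).const_mul 16
    rw [mul_zero] at hlim
    obtain ⟨K, hK⟩ := Filter.eventually_atTop.1 (hlim.eventually (gt_mem_nhds hε))
    refine ⟨K, fun n hn I hk => ?_⟩
    have h2 := hK I.k hk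
    have h3 := I.le_expAlg_div_expMax hn h0 h1 hroot
    have : 16 * (I.k : ℝ) / 2 ^ I.k = 16 * ((I.k : ℝ) * (1 / 2) ^ I.k) := by
      rw [one_div_pow]
      ring
    linarith
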